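/- Let $(M,g)$ be a smooth three-dimensional Riemannian manifold of constant sectional curvature $K$, let $p>0$, let $I=[a,b]$ with $a<b$ and $|I|=b-a$, and let $\gamma\colon I\to M$ be a smooth curve parametrized by arclength which has a smooth Frenet frame $\{T=\gamma',N,B\}$, $$\nabla_TT=kN,\qquad \nabla_TN=-kT+\tau B,\qquad \nabla_TB=-\tau N,$$ with geodesic curvature $k>0$ and torsion $\tau$. Assume that $\gamma$ is $p$-biharmonic, that is, a critical point of $$E_{2,p}(\gamma)=\frac1p\int_I|\nabla_{\gamma'}\gamma'|^p\,ds$$ with respect to smooth variations supported in the interior of $I$ (the parameter $s\in I$ is kept fixed, so the varied curves need not be parametrized by arclength). We write $\operatorname{Hess}(E_{2,p}(\gamma))(N,N)=v$ if for every smooth variation $\gamma_t$ of $\gamma$ with $\partial_t\gamma_t|_{t=0}=N$ which produces no boundary terms, the function $t\mapsto E_{2,p}(\gamma_t)$ is differentiable near $t=0$ and is twice differentiable at $t=0$ with $\frac{d^2}{dt^2}\big|_{t=0}E_{2,p}(\gamma_t)=v$. Here a variation is said to produce no boundary terms if either all $\gamma_t$ are smoothly closed curves (i.e. extend to smooth $|I|$-periodic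 curves, jointly smoothly in $t$), or the acceleration $A=\frac{\nabla}{\partial t}\partial_t\gamma_t\big|_{t=0}$ satisfies $A=0$ and $\nabla_{\gamma'}A=0$ at both end points of $I$ (for instance $\gamma_t=\exp_\gamma(tN)$). Then the following hold. 1. In general, $$\operatorname{Hess}(E_{2,p}(\gamma))(N,N)=\int_I\Big((p-1)k^{p-2}(k^2+\tau^2)^2+(k'^2+\tau'^2)k^{p-2}+(p-1)K^2k^{p-2}-(2p+2)Kk^p+(2-2p)K\tau^2k^{p-2}\Big)ds.$$ 2. If $p\neq\frac12$, then $k$ is constant and $$\operatorname{Hess}(E_{2,p}(\gamma))(N,N)=-4K|I|k^p.$$ 3. If $p=\frac12$, then there is $\alpha\in\mathbb{R}$ with $\tau=\alpha k$ on $I$, and $$\operatorname{Hess}(E_{2,p}(\gamma))(N,N)=\int_I\Big(-\frac{(1+\alpha^2)^2}{2}k^{\frac52}+(1+\alpha^2)k'^2k^{-\frac32}-\frac12K^2k^{-\frac32}-3Kk^{\frac12}+\alpha^2Kk^{\frac12}\Big)ds.$$ -/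

import Mathlib

open Set Filter Topology Manifold
open scoped ContDiff

noncomputable section

namespace PBiharmonic

/-- A smooth Riemannian metric on the `n`-dimensional manifold `M`. -/
abbrev Metric (n : ℕ) (M : Type*) [TopologicalSpace M]
    [ChartedSpace (EuclideanSpace ℝ (Fin n)) M] [IsManifold (𝓡 n) ∞ M] :=
  Bundle.ContMDiffRiemannianMetric (𝓡 n) ∞ (EuclideanSpace ℝ (Fin n))
    (fun x : M => TangentSpace (𝓡 n) x)

/-- Coordinate basis vector. -/
def e {n : ℕ} (i : Fin n) : EuclideanSpace ℝ (Fin n) := EuclideanSpace.single i (1 : ℝ)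

section Geometry

variable {n : ℕ} {M : Type*} [TopologicalSpace M]
  [ChartedSpace (EuclideanSpace ℝ (Fin n)) M] [IsManifold (𝓡 n) ∞ M]

/-- The components `g_ij` of the metric in the preferred chart at `x₀`, as functions of the
coordinate `y`. `tangentCoordChange I x₀ q q` turns components with respect to the chart at `x₀`
into an element of `TangentSpace I q` (which is expressed in the preferred chart at `q`). -/
def gram (g : Metric n M) (x₀ : M) (y : EuclideanSpace ℝ (Fin n)) :
    Matrix (Fin n) (Fin n) ℝ :=
  Matrix.of fun i j =>
    g.inner ((extChartAt (𝓡 n) x₀).symm y)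
      (tangentCoordChange (𝓡 n) x₀ ((extChartAt (𝓡 n) x₀).symm y)
        ((extChartAt (𝓡 n) x₀).symm y) (e i))
      (tangentCoordChange (𝓡 n) x₀ ((extChartAt (𝓡 n) x₀).symm y)
        ((extChartAt (𝓡 n) x₀).symm y) (e j))

/-- The partial derivative `∂_i g_jl` in the chart at `x₀`. -/
def partialGram (g : Metric n M) (x₀ : M) (y : EuclideanSpace ℝ (Fin n)) (i j l : Fin n) : ℝ :=
  fderiv ℝ (fun z => gram g x₀ z j l) y (e i)

/-- The Christoffel symbol `Γ^k_ij` of the Levi-Civita connection in the chart at `x₀`. -/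
def christoffelSymbol (g : Metric n M) (x₀ : M) (y : EuclideanSpace ℝ (Fin n))
    (k i j : Fin n) : ℝ :=
  (1 / 2 : ℝ) * ∑ l, (gram g x₀ y)⁻¹ k l *
    (partialGram g x₀ y i j l + partialGram g x₀ y j i l - partialGram g x₀ y l i j)

/-- The bilinear expression `Γ(v, w) = ∑ Γ^k_ij v^i w^j e_k`. -/
def christoffel (g : Metric n M) (x₀ : M) (y v w : EuclideanSpace ℝ (Fin n)) :
    EuclideanSpace ℝ (Fin n) :=
  WithLp.toLp 2 fun k => ∑ i, ∑ j, christoffelSymbol g x₀ y k i j * v i * w j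

/-- The Riemann curvature tensor
`R(X, Y) Z = ∇_X ∇_Y Z - ∇_Y ∇_X Z - ∇_[X,Y] Z` at `x`, computed in the preferred chart at `x`
(with vector fields of constant components). -/
def curvature (g : Metric n M) (x : M) (X Y Z : TangentSpace (𝓡 n) x) :
    TangentSpace (𝓡 n) x :=
  fderiv ℝ (fun y => christoffel g x y Y Z) (extChartAt (𝓡 n) x x) X
    - fderiv ℝ (fun y => christoffel g x y X Z) (extChartAt (𝓡 n) x x) Y
    + christoffel g x (extChartAt (𝓡 n) x x) X (christoffel g x (extChartAt (𝓡 n) x x) Y Z)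
    - christoffel g x (extChartAt (𝓡 n) x x) Y (christoffel g x (extChartAt (𝓡 n) x x) X Z)

/-- All sectional curvatures of `(M, g)` are equal to `K`. -/
def HasConstantCurvature (g : Metric n M) (K : ℝ) : Prop :=
  ∀ (x : M) (X Y : TangentSpace (𝓡 n) x),
    g.inner x (curvature g x X Y Y) X
      = K * (g.inner x X X * g.inner x Y Y - g.inner x X Y ^ 2)

/-- The velocity `c'(s)` of a curve. -/
def velocity (c : ℝ → M) (s : ℝ) : TangentSpace (𝓡 n) (c s) :=
  mfderiv 𝓘(ℝ, ℝ) (𝓡 n) c s (1 : ℝ)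

/-- The covariant derivative `∇_{c'} X` at `s` of a vector field `X` along the curve `c`, computed
in the preferred chart at `c s`: `(∇X)^k = (X^k)' + Γ^k_ij (c^i)' X^j`. -/
def covDeriv (g : Metric n M) (c : ℝ → M) (X : ∀ s, TangentSpace (𝓡 n) (c s)) (s : ℝ) :
    TangentSpace (𝓡 n) (c s) :=
  deriv (fun u : ℝ =>
      (tangentCoordChange (𝓡 n) (c u) (c s) (c u) (X u) : EuclideanSpace ℝ (Fin n))) s
    + christoffel g (c s) (extChartAt (𝓡 n) (c s) (c s)) (velocity c s) (X s)

/-- The tension field `∇_{c'} c'` of a curve. -/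
def tension (g : Metric n M) (c : ℝ → M) (s : ℝ) : TangentSpace (𝓡 n) (c s) :=
  covDeriv g c (velocity c) s

/-- The `p`-bienergy `(1/p) ∫_a^b |∇_{c'} c'|^p ds` of the restriction of `c` to `[a, b]`. -/
def energy (g : Metric n M) (p a b : ℝ) (c : ℝ → M) : ℝ :=
  (1 / p) * ∫ s in a..b, Real.sqrt (g.inner (c s) (tension g c s) (tension g c s)) ^ p

/-- `Γ` is a smooth variation `(t, s) ↦ Γ t s` of the curve `c = Γ 0`. -/
def IsVariation (n : ℕ) {M : Type*} [TopologicalSpace M]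
    [ChartedSpace (EuclideanSpace ℝ (Fin n)) M] [IsManifold (𝓡 n) ∞ M] (c : ℝ → M) (Γ : ℝ → ℝ → M) : Prop :=
  ContMDiff 𝓘(ℝ, ℝ × ℝ) (𝓡 n) ∞ (fun q : ℝ × ℝ => Γ q.1 q.2) ∧ ∀ s, Γ 0 s = c s

/-- The smooth curve `c : [a, b] → M` is `p`-biharmonic: it is a critical point of the
`p`-bienergy, with respect to all variations supported in the interior of `[a, b]`. -/
def IsPBiharmonic (g : Metric n M) (p a b : ℝ) (c : ℝ → M) : Prop :=
  ContMDiff 𝓘(ℝ, ℝ) (𝓡 n) ∞ c ∧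
  ∀ Γ : ℝ → ℝ → M, IsVariation n c Γ →
    (∃ a' b' : ℝ, a < a' ∧ b' < b ∧ ∀ t s, s ∉ Icc a' b' → Γ t s = c s) →
    HasDerivAt (fun t => energy g p a b (Γ t)) 0 0

/-- The variations of `c : [a, b] → M` with variational vector field `η` which enter the Hessian.
No boundary terms occur: either all curves `Γ t` close up smoothly, or the acceleration
`∇_t ∂_t Γ` at `t = 0` vanishes to first order at both end points (as it does for
`Γ t s = exp (t η(s))`, whose acceleration is zero). -/
structure IsHessianVariation (g : Metric n M) (a b : ℝ) (c : ℝ → M)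
    (η : ∀ s, TangentSpace (𝓡 n) (c s)) (Γ : ℝ → ℝ → M) : Prop where
  variation : IsVariation n c Γ
  field : ∀ s ∈ Icc a b,
    (⟨Γ 0 s, velocity (fun t => Γ t s) 0⟩ : TangentBundle (𝓡 n) M) = ⟨c s, η s⟩
  boundary :
    (∀ t s, Γ t (s + (b - a)) = Γ t s) ∨
    (∀ s : ℝ, s = a ∨ s = b →
      tension g (fun t => Γ t s) 0 = 0 ∧
      covDeriv g (fun u => Γ 0 u) (fun u => tension g (fun t => Γ t u) 0) s = 0)

/-- `Hess(E_{2,p}(c))(η, η) = v`: for every variation of `c` with variational vector field `η`,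
`d²/dt²|_{t=0} E_{2,p}(Γ t)` exists and is equal to `v`. -/
def HasHessian (g : Metric n M) (p a b : ℝ) (c : ℝ → M)
    (η : ∀ s, TangentSpace (𝓡 n) (c s)) (v : ℝ) : Prop :=
  ∀ Γ : ℝ → ℝ → M, IsHessianVariation g a b c η Γ →
    (∀ᶠ t in 𝓝 (0 : ℝ), DifferentiableAt ℝ (fun t => energy g p a b (Γ t)) t) ∧
    HasDerivAt (deriv fun t => energy g p a b (Γ t)) v 0

end Geometry

/-- `{T = c', N, B}` is a smooth Frenet frame, with geodesic curvature `k > 0` and torsion `τ`,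
along the unit speed curve `c : [a, b] → M` in a three-dimensional Riemannian manifold. -/
structure IsFrenetFrame {M : Type*} [TopologicalSpace M]
    [ChartedSpace (EuclideanSpace ℝ (Fin 3)) M] [IsManifold (𝓡 3) ∞ M]
    (g : Metric 3 M) (a b : ℝ) (c : ℝ → M) (N B : ∀ s, TangentSpace (𝓡 3) (c s))
    (k τ : ℝ → ℝ) : Prop where
  smooth_N : ContMDiff 𝓘(ℝ, ℝ) (𝓡 3).tangent ∞
    (fun s => (⟨c s, N s⟩ : TangentBundle (𝓡 3) M))
  smooth_B : ContMDiff 𝓘(ℝ, ℝ) (𝓡 3).tangent ∞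
    (fun s => (⟨c s, B s⟩ : TangentBundle (𝓡 3) M))
  smooth_k : ContDiff ℝ ∞ k
  smooth_τ : ContDiff ℝ ∞ τ
  inner_TT : ∀ s ∈ Icc a b, g.inner (c s) (velocity c s) (velocity c s) = 1
  inner_NN : ∀ s ∈ Icc a b, g.inner (c s) (N s) (N s) = 1
  inner_BB : ∀ s ∈ Icc a b, g.inner (c s) (B s) (B s) = 1
  inner_TN : ∀ s ∈ Icc a b, g.inner (c s) (velocity c s) (N s) = 0
  inner_TB : ∀ s ∈ Icc a b, g.inner (c s) (velocity c s) (B s) = 0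
  inner_NB : ∀ s ∈ Icc a b, g.inner (c s) (N s) (B s) = 0
  k_pos : ∀ s ∈ Icc a b, 0 < k s
  deriv_T : ∀ s ∈ Icc a b, covDeriv g c (velocity c) s = k s • N s
  deriv_N : ∀ s ∈ Icc a b, covDeriv g c N s = -(k s • velocity c s) + τ s • B s
  deriv_B : ∀ s ∈ Icc a b, covDeriv g c B s = -(τ s • N s)

end PBiharmonic

end

/-!
The formula for the Hessian is obtained by differentiating the energy density
`|∇_s ∂_s γ_t| ^ p / p` twice under the integral sign, which is possible because the curvature of
`γ` is positive on a compact interval.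

Write `T = ∂_s γ_t`, `V = ∂_t γ_t`, `W = ∇_s T` and `A = ∇_t V`. Torsion-freeness and the Ricci
identity give `∇_t W = ∇_s ∇_s V + R(V, T)T`, the Jacobi operator applied to `V`
(`covDir_tension`). In constant curvature, where `R(X, Y)Z` is an explicit combination of `X` and
`Y` (`curv_eq_of_hasConstantCurvature`), one more derivative gives the Jacobi operator applied to
`A`, plus terms without second derivatives (`covDir_covDir_tension`). The Jacobi operator is
formally self-adjoint (`integral_jacobi`), and it annihilates the momentum `|W| ^ (p - 2) W` of a
`p`-biharmonic curve: that is the Euler–Lagrange equation (`jacobi_momentum_eq_zero`), obtained by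
testing the first variation with bumps in a chart. So `A` contributes only a boundary term, which
vanishes for the admitted variations, and what remains is computed in the Frenet frame
(`FrenetSystem.density₂_slice`, `FrenetSystem.hasHessian`).

In the Frenet frame, with `f = k ^ (p - 1)`, the Euler–Lagrange equation reads `2 k f' + f k' = 0`,
`f'' + (K - k² - τ²) f = 0` and `2 τ f' + f τ' = 0` (`FrenetSystem.eulerLagrange`). The first
equation is `(2p - 1) k ^ (p - 1) k' = 0`, hence `k` is constant if `p ≠ 1 / 2`, and then `τ` is
constant and `k² + τ² = K`. If `p = 1 / 2` the last equation says that `τ / k` is constant.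

Since `covDeriv` and `curvature` are defined through the preferred chart at each point, the
computations require that the covariant derivative has the same expression in every chart
(`toChart_covDir`). This follows from the transformation law of the Christoffel symbols, which is
derived from the Koszul formula. Vector fields along a map are represented throughout by
functions into the model space, the value at `q` being a tangent vector at `F q` written in the
preferred chart at `F q`. Maps `F : P → M` from a normed space `P` are used, so that curves
(`P = ℝ`) and variations (`P = ℝ × ℝ`) are treated alike.
-/

noncomputable section

namespace PBiharmonic

/-! ### Charts and the metric in coordinates -/

section Charts

/-- Stated over abstract normed spaces, so that for spaces of bilinear forms on the model space the
scalar action is the one of the normed space structure. -/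
lemma contDiffAt_smul_fixed {E F : Type*} [NormedAddCommGroup E] [NormedSpace ℝ E]
    [NormedAddCommGroup F] [NormedSpace ℝ F] {f : E → ℝ} {y : E} (h : ContDiffAt ℝ ∞ f y) (c : F) :
    ContDiffAt ℝ ∞ (fun z => f z • c) y :=
  h.smul contDiffAt_const

variable {n : ℕ} {M : Type*} [TopologicalSpace M]
  [ChartedSpace (EuclideanSpace ℝ (Fin n)) M] [IsManifold (𝓡 n) ∞ M]

/-- The components in the chart at `x₀` of a tangent vector `v` at `x`, itself given by its
components in the preferred chart at `x`. -/
def toChart (x₀ x : M) : EuclideanSpace ℝ (Fin n) →L[ℝ] EuclideanSpace ℝ (Fin n) :=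
  tangentCoordChange (𝓡 n) x x₀ x

/-- The tangent vector at `x`, written in the preferred chart at `x`, whose components in the chart
at `x₀` are `v`. -/
def fromChart (x₀ x : M) : EuclideanSpace ℝ (Fin n) →L[ℝ] EuclideanSpace ℝ (Fin n) :=
  tangentCoordChange (𝓡 n) x₀ x x

/-- The transition map from the chart at `x₀` to the chart at `x₁`. -/
def transition (x₀ x₁ : M) (y : EuclideanSpace ℝ (Fin n)) : EuclideanSpace ℝ (Fin n) :=
  extChartAt (𝓡 n) x₁ ((extChartAt (𝓡 n) x₀).symm y)

lemma toChart_fromChart {x₀ x : M} (h : x ∈ (extChartAt (𝓡 n) x₀).source)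
    (v : EuclideanSpace ℝ (Fin n)) : toChart x₀ x (fromChart x₀ x v) = v := by
  unfold toChart fromChart
  rw [tangentCoordChange_comp ⟨⟨h, mem_extChartAt_source x⟩, h⟩, tangentCoordChange_self h]

lemma fromChart_toChart {x₀ x : M} (h : x ∈ (extChartAt (𝓡 n) x₀).source)
    (v : EuclideanSpace ℝ (Fin n)) : fromChart x₀ x (toChart x₀ x v) = v := by
  unfold toChart fromChart
  rw [tangentCoordChange_comp ⟨⟨mem_extChartAt_source x, h⟩, mem_extChartAt_source x⟩,
    tangentCoordChange_self (mem_extChartAt_source x)]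

lemma toChart_self (x : M) (v : EuclideanSpace ℝ (Fin n)) : toChart x x v = v :=
  tangentCoordChange_self (mem_extChartAt_source x)

lemma contMDiffAt_extChartAt_symm_of_mem {x₀ : M} {y : EuclideanSpace ℝ (Fin n)}
    (hy : y ∈ (extChartAt (𝓡 n) x₀).target) :
    ContMDiffAt 𝓘(ℝ, EuclideanSpace ℝ (Fin n)) (𝓡 n) ∞ (extChartAt (𝓡 n) x₀).symm y :=
  (contMDiffOn_extChartAt_symm x₀).contMDiffAt ((isOpen_extChartAt_target x₀).mem_nhds hy)

lemma eventually_symm_mem_source {x₀ x₁ : M} {y : EuclideanSpace ℝ (Fin n)}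
    (hy : y ∈ (extChartAt (𝓡 n) x₀).target)
    (h : (extChartAt (𝓡 n) x₀).symm y ∈ (extChartAt (𝓡 n) x₁).source) :
    ∀ᶠ z in 𝓝 y, z ∈ (extChartAt (𝓡 n) x₀).target ∧
      (extChartAt (𝓡 n) x₀).symm z ∈ (extChartAt (𝓡 n) x₁).source := by
  have h₀ : ∀ᶠ z in 𝓝 y, z ∈ (extChartAt (𝓡 n) x₀).target :=
    (isOpen_extChartAt_target x₀).mem_nhds hy
  refine h₀.and ?_
  exact (contMDiffAt_extChartAt_symm_of_mem hy).continuousAt.eventually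
    ((isOpen_extChartAt_source x₁).mem_nhds h)

lemma contDiffAt_transition {x₀ x₁ : M} {y : EuclideanSpace ℝ (Fin n)}
    (hy : y ∈ (extChartAt (𝓡 n) x₀).target)
    (h : (extChartAt (𝓡 n) x₀).symm y ∈ (extChartAt (𝓡 n) x₁).source) :
    ContDiffAt ℝ ∞ (transition x₀ x₁) y := by
  rw [← contMDiffAt_iff_contDiffAt]
  exact (contMDiffAt_extChartAt' (by rwa [extChartAt_source] at h)).comp y
    (contMDiffAt_extChartAt_symm_of_mem hy)

lemma fderiv_transition {x₀ x₁ : M} {y : EuclideanSpace ℝ (Fin n)}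
    (hy : y ∈ (extChartAt (𝓡 n) x₀).target) :
    fderiv ℝ (transition x₀ x₁) y
      = tangentCoordChange (𝓡 n) x₀ x₁ ((extChartAt (𝓡 n) x₀).symm y) := by
  rw [tangentCoordChange_def, (extChartAt (𝓡 n) x₀).right_inv hy]
  have : range (𝓡 n) = univ := by simp
  rw [this, fderivWithin_univ]
  rfl

lemma fderiv_transition_toChart {x₀ x₁ x : M} (h₀ : x ∈ (extChartAt (𝓡 n) x₀).source)
    (h₁ : x ∈ (extChartAt (𝓡 n) x₁).source) (v : EuclideanSpace ℝ (Fin n)) :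
    fderiv ℝ (transition x₀ x₁) (extChartAt (𝓡 n) x₀ x) (toChart x₀ x v) = toChart x₁ x v := by
  rw [fderiv_transition ((extChartAt (𝓡 n) x₀).map_source h₀),
    (extChartAt (𝓡 n) x₀).left_inv h₀]
  exact tangentCoordChange_comp ⟨⟨mem_extChartAt_source x, h₀⟩, h₁⟩

lemma contDiffAt_gram (g : Metric n M) {x₀ : M} {y : EuclideanSpace ℝ (Fin n)}
    (hy : y ∈ (extChartAt (𝓡 n) x₀).target) (i j : Fin n) :
    ContDiffAt ℝ ∞ (fun z => gram g x₀ z i j) y := by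
  have hs := contMDiffAt_extChartAt_symm_of_mem hy
  have hv : ∀ v : EuclideanSpace ℝ (Fin n),
      ContMDiffAt 𝓘(ℝ, EuclideanSpace ℝ (Fin n)) (𝓡 n).tangent ∞
      (fun z => (⟨(extChartAt (𝓡 n) x₀).symm z,
        fromChart x₀ ((extChartAt (𝓡 n) x₀).symm z) v⟩ : TangentBundle (𝓡 n) M)) y := by
    intro v
    refine Bundle.contMDiffAt_totalSpace.2 ⟨hs, ?_⟩
    set x₁ := (extChartAt (𝓡 n) x₀).symm y with hx₁
    have hmem := eventually_symm_mem_source (x₁ := x₁) hy (mem_extChartAt_source x₁)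
    have hd : ContDiffAt ℝ ∞ (fun z => fderiv ℝ (transition x₀ x₁) z v) y :=
      ((contDiffAt_transition hy (mem_extChartAt_source x₁)).fderiv_right
        (m := ∞) (by simp)).clm_apply contDiffAt_const
    refine (contMDiffAt_iff_contDiffAt.2 hd).congr_of_eventuallyEq ?_
    filter_upwards [hmem] with z hz
    have h0 : (extChartAt (𝓡 n) x₀).symm z ∈ (extChartAt (𝓡 n) x₀).source :=
      (extChartAt (𝓡 n) x₀).map_target hz.1
    change toChart x₁ _ _ = _
    rw [fderiv_transition hz.1]
    exact tangentCoordChange_comp ⟨⟨h0, mem_extChartAt_source _⟩, hz.2⟩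
  have h1 : ContMDiffAt 𝓘(ℝ, EuclideanSpace ℝ (Fin n)) ((𝓡 n).prod 𝓘(ℝ, ℝ)) ∞
      (fun z => Bundle.TotalSpace.mk' ℝ (E := Bundle.Trivial M ℝ) ((extChartAt (𝓡 n) x₀).symm z)
        (gram g x₀ z i j)) y := by
    refine ContMDiffAt.clm_bundle_apply₂ (F₁ := EuclideanSpace ℝ (Fin n))
      (F₂ := EuclideanSpace ℝ (Fin n)) ?_ (hv (e i)) (hv (e j))
    exact ContMDiffAt.comp y g.contMDiff.contMDiffAt hs
  rw [Bundle.contMDiffAt_totalSpace] at h1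
  exact contMDiffAt_iff_contDiffAt.1 h1.2

/-- The metric in the chart at `x₀`, as a family of continuous bilinear forms on the model space. -/
def chartMetric (g : Metric n M) (x₀ : M) (y : EuclideanSpace ℝ (Fin n)) :
    EuclideanSpace ℝ (Fin n) →L[ℝ] EuclideanSpace ℝ (Fin n) →L[ℝ] ℝ :=
  ∑ i, ∑ j, gram g x₀ y i j •
    ((EuclideanSpace.proj i : EuclideanSpace ℝ (Fin n) →L[ℝ] ℝ).smulRight
      (EuclideanSpace.proj j : EuclideanSpace ℝ (Fin n) →L[ℝ] ℝ))

/-- The Christoffel symbols in the chart at `x₀`, as a family of continuous bilinear maps. -/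
def chartChristoffel (g : Metric n M) (x₀ : M) (y : EuclideanSpace ℝ (Fin n)) :
    EuclideanSpace ℝ (Fin n) →L[ℝ] EuclideanSpace ℝ (Fin n) →L[ℝ] EuclideanSpace ℝ (Fin n) :=
  ∑ k, ∑ i, ∑ j, christoffelSymbol g x₀ y k i j •
    ((EuclideanSpace.proj i : EuclideanSpace ℝ (Fin n) →L[ℝ] ℝ).smulRight
      ((EuclideanSpace.proj j : EuclideanSpace ℝ (Fin n) →L[ℝ] ℝ).smulRight (e k)))

lemma chartMetric_apply (g : Metric n M) (x₀ : M) (y v w : EuclideanSpace ℝ (Fin n)) :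
    chartMetric g x₀ y v w = ∑ i, ∑ j, gram g x₀ y i j * (v i * w j) := by
  simp [chartMetric]

lemma chartChristoffel_apply (g : Metric n M) (x₀ : M) (y v w : EuclideanSpace ℝ (Fin n)) :
    chartChristoffel g x₀ y v w = christoffel g x₀ y v w := by
  ext k
  simp [chartChristoffel, christoffel]
  have h : ∀ l, (e l : EuclideanSpace ℝ (Fin n)).ofLp k = if k = l then 1 else 0 := fun l => by
    simp [e]
  simp only [h]
  rw [Finset.sum_eq_single k]
  · simp [mul_assoc]
  · intro l _ hl
    simp [hl.symm]
  · simp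

lemma eq_sum_e (v : EuclideanSpace ℝ (Fin n)) : v = ∑ i, v i • e i := by
  ext k
  simp [e, Pi.single_apply]

/-- The metric on tangent vectors, seen as a function on the model space. -/
def metric (g : Metric n M) (x : M) (v w : EuclideanSpace ℝ (Fin n)) : ℝ := g.inner x v w

lemma metric_symm (g : Metric n M) (x : M) (v w : EuclideanSpace ℝ (Fin n)) :
    metric g x v w = metric g x w v := g.symm x v w

lemma metric_pos (g : Metric n M) (x : M) {v : EuclideanSpace ℝ (Fin n)} (hv : v ≠ 0) :
    0 < metric g x v v := g.pos x v hv

lemma metric_add_left (g : Metric n M) (x : M) (u v w : EuclideanSpace ℝ (Fin n)) :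
    metric g x (u + v) w = metric g x u w + metric g x v w := by
  have h := (g.inner x).map_add u v
  exact congrArg (fun L => L w) h

lemma metric_smul_left (g : Metric n M) (x : M) (c : ℝ) (v w : EuclideanSpace ℝ (Fin n)) :
    metric g x (c • v) w = c * metric g x v w := by
  have h := (g.inner x).map_smul c v
  exact congrArg (fun L => L w) h

lemma metric_add_right (g : Metric n M) (x : M) (u v w : EuclideanSpace ℝ (Fin n)) :
    metric g x w (u + v) = metric g x w u + metric g x w v := by
  rw [metric_symm, metric_add_left, metric_symm, metric_symm g x v]

lemma metric_smul_right (g : Metric n M) (x : M) (c : ℝ) (v w : EuclideanSpace ℝ (Fin n)) :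
    metric g x w (c • v) = c * metric g x w v := by
  rw [metric_symm, metric_smul_left, metric_symm]

/-- The metric at `x` as a bilinear form on the model space. -/
def metricForm (g : Metric n M) (x : M) :
    EuclideanSpace ℝ (Fin n) →ₗ[ℝ] EuclideanSpace ℝ (Fin n) →ₗ[ℝ] ℝ :=
  LinearMap.mk₂ ℝ (metric g x) (metric_add_left g x) (metric_smul_left g x)
    (fun w u v => metric_add_right g x u v w) (fun c w v => metric_smul_right g x c v w)

lemma metricForm_apply (g : Metric n M) (x : M) (v w : EuclideanSpace ℝ (Fin n)) :
    metricForm g x v w = metric g x v w := rfl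

lemma chartMetric_eq (g : Metric n M) (x₀ : M) (y v w : EuclideanSpace ℝ (Fin n)) :
    chartMetric g x₀ y v w = metric g ((extChartAt (𝓡 n) x₀).symm y)
      (fromChart x₀ ((extChartAt (𝓡 n) x₀).symm y) v)
      (fromChart x₀ ((extChartAt (𝓡 n) x₀).symm y) w) := by
  rw [chartMetric_apply, ← metricForm_apply]
  conv_rhs => rw [eq_sum_e v, eq_sum_e w]
  simp only [map_sum, map_smul, LinearMap.sum_apply, LinearMap.smul_apply, smul_eq_mul,
    Finset.mul_sum]
  rw [Finset.sum_comm]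
  refine Finset.sum_congr rfl fun j _ => Finset.sum_congr rfl fun i _ => ?_
  change metric _ _ _ _ * _ = _ * (_ * metric _ _ _ _)
  simp only [fromChart]
  ring

lemma metric_eq_chartMetric (g : Metric n M) {x₀ x : M} (h : x ∈ (extChartAt (𝓡 n) x₀).source)
    (v w : EuclideanSpace ℝ (Fin n)) :
    metric g x v w
      = chartMetric g x₀ (extChartAt (𝓡 n) x₀ x) (toChart x₀ x v) (toChart x₀ x w) := by
  rw [chartMetric_eq, (extChartAt (𝓡 n) x₀).left_inv h, fromChart_toChart h, fromChart_toChart h]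

lemma chartMetric_symm (g : Metric n M) (x₀ : M) (y v w : EuclideanSpace ℝ (Fin n)) :
    chartMetric g x₀ y v w = chartMetric g x₀ y w v := by
  rw [chartMetric_eq, metric_symm, ← chartMetric_eq]

lemma gram_symm (g : Metric n M) (x₀ : M) (y : EuclideanSpace ℝ (Fin n)) (i j : Fin n) :
    gram g x₀ y i j = gram g x₀ y j i := g.symm _ _ _

lemma chartMetric_pos (g : Metric n M) {x₀ : M} {y : EuclideanSpace ℝ (Fin n)}
    (hy : y ∈ (extChartAt (𝓡 n) x₀).target) {v : EuclideanSpace ℝ (Fin n)} (hv : v ≠ 0) :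
    0 < chartMetric g x₀ y v v := by
  rw [chartMetric_eq]
  refine metric_pos g _ fun h => hv ?_
  rw [← toChart_fromChart ((extChartAt (𝓡 n) x₀).map_target hy) v, h, map_zero]

lemma chartMetric_ext (g : Metric n M) {x₀ : M} {y : EuclideanSpace ℝ (Fin n)}
    (hy : y ∈ (extChartAt (𝓡 n) x₀).target) {v w : EuclideanSpace ℝ (Fin n)}
    (h : ∀ z, chartMetric g x₀ y v z = chartMetric g x₀ y w z) : v = w := by
  by_contra hne
  have := chartMetric_pos g hy (sub_ne_zero.2 hne)
  rw [map_sub (chartMetric g x₀ y) v w, sub_apply, h, sub_self] at this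
  exact lt_irrefl _ this

lemma isUnit_det_gram (g : Metric n M) {x₀ : M} {y : EuclideanSpace ℝ (Fin n)}
    (hy : y ∈ (extChartAt (𝓡 n) x₀).target) : IsUnit (gram g x₀ y).det := by
  rw [isUnit_iff_ne_zero]
  intro h0
  obtain ⟨v, hv, h⟩ := Matrix.exists_mulVec_eq_zero_iff.2 h0
  have hv' : (WithLp.toLp 2 v : EuclideanSpace ℝ (Fin n)) ≠ 0 := by simpa using hv
  have := chartMetric_pos g hy hv'
  rw [chartMetric_apply] at this
  have h2 : ∀ i, ∑ j, gram g x₀ y i j * v j = 0 := fun i => congrFun h i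
  have h3 : ∑ i, ∑ j, gram g x₀ y i j * (v i * v j) = 0 := by
    refine Finset.sum_eq_zero fun i _ => ?_
    rw [← mul_zero (v i), ← h2 i, Finset.mul_sum]
    exact Finset.sum_congr rfl fun j _ => by ring
  simp only at this
  linarith

lemma contDiffAt_chartMetric (g : Metric n M) {x₀ : M} {y : EuclideanSpace ℝ (Fin n)}
    (hy : y ∈ (extChartAt (𝓡 n) x₀).target) : ContDiffAt ℝ ∞ (chartMetric g x₀) y := by
  unfold chartMetric
  exact ContDiffAt.sum fun i _ => ContDiffAt.sum fun j _ =>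
    contDiffAt_smul_fixed (contDiffAt_gram g hy i j) _

lemma contDiffAt_partialGram (g : Metric n M) {x₀ : M} {y : EuclideanSpace ℝ (Fin n)}
    (hy : y ∈ (extChartAt (𝓡 n) x₀).target) (i j l : Fin n) :
    ContDiffAt ℝ ∞ (fun z => partialGram g x₀ z i j l) y :=
  ((contDiffAt_gram g hy j l).fderiv_right (m := ∞) (by simp)).clm_apply contDiffAt_const

lemma contDiffAt_det {E : Type*} [NormedAddCommGroup E] [NormedSpace ℝ E]
    {ι : Type*} [Fintype ι] [DecidableEq ι] {A : E → Matrix ι ι ℝ} {y : E}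
    (h : ∀ i j, ContDiffAt ℝ ∞ (fun z => A z i j) y) :
    ContDiffAt ℝ ∞ (fun z => (A z).det) y := by
  simp only [Matrix.det_apply']
  exact ContDiffAt.sum fun σ _ => contDiffAt_const.mul (contDiffAt_prod fun i _ => h _ _)

lemma contDiffAt_gram_inv (g : Metric n M) {x₀ : M} {y : EuclideanSpace ℝ (Fin n)}
    (hy : y ∈ (extChartAt (𝓡 n) x₀).target) (i j : Fin n) :
    ContDiffAt ℝ ∞ (fun z => (gram g x₀ z)⁻¹ i j) y := by
  have h1 : ContDiffAt ℝ ∞ (fun z => (gram g x₀ z).det) y := contDiffAt_det (contDiffAt_gram g hy)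
  have h2 : ContDiffAt ℝ ∞ (fun z => (gram g x₀ z).adjugate i j) y := by
    simp only [Matrix.adjugate_apply]
    refine contDiffAt_det fun k l => ?_
    simp only [Matrix.updateRow_apply]
    split_ifs
    · exact contDiffAt_const
    · exact contDiffAt_gram g hy k l
  simp only [Matrix.inv_def, Ring.inverse_eq_inv', Matrix.smul_apply, smul_eq_mul]
  exact (h1.inv (isUnit_det_gram g hy).ne_zero).mul h2

lemma contDiffAt_chartChristoffel (g : Metric n M) {x₀ : M} {y : EuclideanSpace ℝ (Fin n)}
    (hy : y ∈ (extChartAt (𝓡 n) x₀).target) : ContDiffAt ℝ ∞ (chartChristoffel g x₀) y := by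
  unfold chartChristoffel
  refine ContDiffAt.sum fun k _ => ContDiffAt.sum fun i _ => ContDiffAt.sum fun j _ =>
    contDiffAt_smul_fixed ?_ _
  unfold christoffelSymbol
  exact contDiffAt_const.mul (ContDiffAt.sum fun l _ => (contDiffAt_gram_inv g hy k l).mul
    (((contDiffAt_partialGram g hy i j l).add (contDiffAt_partialGram g hy j i l)).sub
      (contDiffAt_partialGram g hy l i j)))

end Charts

/-! ### Christoffel symbols and their transformation law -/

section Christoffel

/-- The product rule for a bilinear form at a moving point, applied to moving vectors. -/
lemma exists_hasFDerivAt_bilin {E F P : Type*} [NormedAddCommGroup E] [NormedSpace ℝ E]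
    [NormedAddCommGroup F] [NormedSpace ℝ F] [NormedAddCommGroup P] [NormedSpace ℝ P]
    {G : E → E →L[ℝ] E →L[ℝ] F} {G' : E →L[ℝ] E →L[ℝ] E →L[ℝ] F}
    {ψ v w : P → E} {L v' w' : P →L[ℝ] E} {y : P} (hG : HasFDerivAt G G' (ψ y))
    (hψ : HasFDerivAt ψ L y) (hv : HasFDerivAt v v' y) (hw : HasFDerivAt w w' y) :
    ∃ T : P →L[ℝ] F, HasFDerivAt (fun z => G (ψ z) (v z) (w z)) T y ∧
      ∀ u, T u = G' (L u) (v y) (w y) + G (ψ y) (v' u) (w y) + G (ψ y) (v y) (w' u) := by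
  refine ⟨_, ((hG.comp y hψ).clm_apply hv).clm_apply hw, fun u => ?_⟩
  simp
  abel

variable {n : ℕ} {M : Type*} [TopologicalSpace M]
  [ChartedSpace (EuclideanSpace ℝ (Fin n)) M] [IsManifold (𝓡 n) ∞ M]

lemma hasFDerivAt_chartMetric (g : Metric n M) {x₀ : M} {y : EuclideanSpace ℝ (Fin n)}
    (hy : y ∈ (extChartAt (𝓡 n) x₀).target) :
    HasFDerivAt (chartMetric g x₀) (fderiv ℝ (chartMetric g x₀) y) y :=
  ((contDiffAt_chartMetric g hy).differentiableAt (by simp)).hasFDerivAt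

lemma hasFDerivAt_chartMetric_apply (g : Metric n M) {x₀ : M} {y : EuclideanSpace ℝ (Fin n)}
    (hy : y ∈ (extChartAt (𝓡 n) x₀).target) (v w : EuclideanSpace ℝ (Fin n)) :
    HasFDerivAt (fun z => chartMetric g x₀ z v w)
      (((fderiv ℝ (chartMetric g x₀) y).flip v).flip w) y := by
  have h := ((hasFDerivAt_chartMetric g hy).clm_apply (hasFDerivAt_const v y)).clm_apply
    (hasFDerivAt_const w y)
  refine h.congr_fderiv ?_
  ext u
  simp

lemma fderiv_chartMetric_symm (g : Metric n M) {x₀ : M} {y : EuclideanSpace ℝ (Fin n)}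
    (hy : y ∈ (extChartAt (𝓡 n) x₀).target) (u v w : EuclideanSpace ℝ (Fin n)) :
    fderiv ℝ (chartMetric g x₀) y u v w = fderiv ℝ (chartMetric g x₀) y u w v := by
  have h1 := hasFDerivAt_chartMetric_apply g hy v w
  have h2 := hasFDerivAt_chartMetric_apply g hy w v
  simp only [chartMetric_symm g x₀ _ v w] at h1
  exact congrArg (fun L => L u) (h1.unique h2)

lemma gram_eq_chartMetric (g : Metric n M) (x₀ : M) (y : EuclideanSpace ℝ (Fin n)) (i j : Fin n) :
    gram g x₀ y i j = chartMetric g x₀ y (e i) (e j) := by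
  rw [chartMetric_eq]; rfl

lemma partialGram_eq (g : Metric n M) {x₀ : M} {y : EuclideanSpace ℝ (Fin n)}
    (hy : y ∈ (extChartAt (𝓡 n) x₀).target) (i j l : Fin n) :
    partialGram g x₀ y i j l = fderiv ℝ (chartMetric g x₀) y (e i) (e j) (e l) := by
  unfold partialGram
  simp only [gram_eq_chartMetric]
  rw [(hasFDerivAt_chartMetric_apply g hy (e j) (e l)).fderiv]
  rfl

lemma koszul_basis (g : Metric n M) {x₀ : M} {y : EuclideanSpace ℝ (Fin n)}
    (hy : y ∈ (extChartAt (𝓡 n) x₀).target) (i j l : Fin n) :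
    2 * chartMetric g x₀ y (chartChristoffel g x₀ y (e i) (e j)) (e l)
      = fderiv ℝ (chartMetric g x₀) y (e i) (e j) (e l)
        + fderiv ℝ (chartMetric g x₀) y (e j) (e i) (e l)
        - fderiv ℝ (chartMetric g x₀) y (e l) (e i) (e j) := by
  have hC : chartChristoffel g x₀ y (e i) (e j) = ∑ k, christoffelSymbol g x₀ y k i j • e k := by
    rw [eq_sum_e (chartChristoffel g x₀ y (e i) (e j)), chartChristoffel_apply]
    refine Finset.sum_congr rfl fun k _ => ?_
    simp [christoffel, e]
  have hinv : ∀ m, ∑ k, gram g x₀ y l k * (gram g x₀ y)⁻¹ k m = if l = m then 1 else 0 := by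
    intro m
    have := congrFun (congrFun (Matrix.mul_nonsing_inv _ (isUnit_det_gram g hy)) l) m
    simpa [Matrix.mul_apply, Matrix.one_apply] using this
  simp only [← partialGram_eq g hy]
  rw [hC, map_sum, sum_apply]
  simp only [map_smul, smul_apply, ← gram_eq_chartMetric, smul_eq_mul, christoffelSymbol]
  set P : Fin n → ℝ := fun m =>
    partialGram g x₀ y i j m + partialGram g x₀ y j i m - partialGram g x₀ y m i j with hP
  calc 2 * ∑ k, 1 / 2 * (∑ m, (gram g x₀ y)⁻¹ k m * P m) * gram g x₀ y k l
      = ∑ k, ∑ m, gram g x₀ y l k * (gram g x₀ y)⁻¹ k m * P m := by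
        rw [Finset.mul_sum]
        refine Finset.sum_congr rfl fun k _ => ?_
        rw [gram_symm g x₀ y k l, Finset.mul_sum, Finset.sum_mul, Finset.mul_sum]
        exact Finset.sum_congr rfl fun m _ => by ring
    _ = ∑ m, (∑ k, gram g x₀ y l k * (gram g x₀ y)⁻¹ k m) * P m := by
        rw [Finset.sum_comm]
        exact Finset.sum_congr rfl fun m _ => by rw [Finset.sum_mul]
    _ = P l := by simp [hinv]

/-- The Koszul formula in a chart. -/
lemma koszul (g : Metric n M) {x₀ : M} {y : EuclideanSpace ℝ (Fin n)}
    (hy : y ∈ (extChartAt (𝓡 n) x₀).target) (u v w : EuclideanSpace ℝ (Fin n)) :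
    2 * chartMetric g x₀ y (chartChristoffel g x₀ y u v) w
      = fderiv ℝ (chartMetric g x₀) y u v w + fderiv ℝ (chartMetric g x₀) y v u w
        - fderiv ℝ (chartMetric g x₀) y w u v := by
  set G := chartMetric g x₀ y
  set C := chartChristoffel g x₀ y
  set D := fderiv ℝ (chartMetric g x₀) y
  have key : ∀ i j l, 2 * G (C (e i) (e j)) (e l)
      = D (e i) (e j) (e l) + D (e j) (e i) (e l) - D (e l) (e i) (e j) := koszul_basis g hy
  have h1 : ∀ u j l, 2 * G (C u (e j)) (e l)
      = D u (e j) (e l) + D (e j) u (e l) - D (e l) u (e j) := by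
    intro u j l
    rw [eq_sum_e u]
    simp only [map_sum, map_smul, sum_apply, smul_apply, Finset.mul_sum,
      ← Finset.sum_add_distrib, ← Finset.sum_sub_distrib, smul_eq_mul]
    exact Finset.sum_congr rfl fun i _ => by linear_combination u i * key i j l
  have h2 : ∀ u v l, 2 * G (C u v) (e l) = D u v (e l) + D v u (e l) - D (e l) u v := by
    intro u v l
    rw [eq_sum_e v]
    simp only [map_sum, map_smul, sum_apply, smul_apply, Finset.mul_sum,
      ← Finset.sum_add_distrib, ← Finset.sum_sub_distrib, smul_eq_mul]
    exact Finset.sum_congr rfl fun i _ => by linear_combination v i * h1 u i l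
  rw [eq_sum_e w]
  simp only [map_sum, map_smul, sum_apply, smul_apply, Finset.mul_sum,
    ← Finset.sum_add_distrib, ← Finset.sum_sub_distrib, smul_eq_mul]
  exact Finset.sum_congr rfl fun i _ => by linear_combination w i * h2 u v i

/-- The Levi-Civita connection is torsion free. -/
lemma chartChristoffel_symm (g : Metric n M) {x₀ : M} {y : EuclideanSpace ℝ (Fin n)}
    (hy : y ∈ (extChartAt (𝓡 n) x₀).target) (u v : EuclideanSpace ℝ (Fin n)) :
    chartChristoffel g x₀ y u v = chartChristoffel g x₀ y v u := by
  refine chartMetric_ext g hy fun w => ?_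
  linarith [koszul g hy u v w, koszul g hy v u w, fderiv_chartMetric_symm g hy w u v]

/-- The Levi-Civita connection is compatible with the metric. -/
lemma fderiv_chartMetric (g : Metric n M) {x₀ : M} {y : EuclideanSpace ℝ (Fin n)}
    (hy : y ∈ (extChartAt (𝓡 n) x₀).target) (u v w : EuclideanSpace ℝ (Fin n)) :
    fderiv ℝ (chartMetric g x₀) y u v w
      = chartMetric g x₀ y (chartChristoffel g x₀ y u v) w
        + chartMetric g x₀ y v (chartChristoffel g x₀ y u w) := by
  rw [chartMetric_symm g x₀ y v]
  linarith [koszul g hy u v w, koszul g hy u w v, fderiv_chartMetric_symm g hy u v w]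

lemma chartMetric_transition (g : Metric n M) {x₀ x₁ : M} {y : EuclideanSpace ℝ (Fin n)}
    (hy : y ∈ (extChartAt (𝓡 n) x₀).target)
    (h : (extChartAt (𝓡 n) x₀).symm y ∈ (extChartAt (𝓡 n) x₁).source)
    (v w : EuclideanSpace ℝ (Fin n)) :
    chartMetric g x₀ y v w = chartMetric g x₁ (transition x₀ x₁ y)
      (fderiv ℝ (transition x₀ x₁) y v) (fderiv ℝ (transition x₀ x₁) y w) := by
  have h0 := (extChartAt (𝓡 n) x₀).map_target hy
  have key : ∀ v, toChart x₁ ((extChartAt (𝓡 n) x₀).symm y)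
      (fromChart x₀ ((extChartAt (𝓡 n) x₀).symm y) v) = fderiv ℝ (transition x₀ x₁) y v := by
    intro v
    rw [fderiv_transition hy]
    exact tangentCoordChange_comp ⟨⟨h0, mem_extChartAt_source _⟩, h⟩
  rw [chartMetric_eq, metric_eq_chartMetric g h, key, key]
  rfl

lemma fderiv_transition_surjective {x₀ x₁ : M} {y : EuclideanSpace ℝ (Fin n)}
    (hy : y ∈ (extChartAt (𝓡 n) x₀).target)
    (h : (extChartAt (𝓡 n) x₀).symm y ∈ (extChartAt (𝓡 n) x₁).source) :
    Function.Surjective (fderiv ℝ (transition x₀ x₁) y) := by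
  intro w
  have h0 := (extChartAt (𝓡 n) x₀).map_target hy
  refine ⟨tangentCoordChange (𝓡 n) x₁ x₀ ((extChartAt (𝓡 n) x₀).symm y) w, ?_⟩
  rw [fderiv_transition hy, tangentCoordChange_comp ⟨⟨h, h0⟩, h⟩, tangentCoordChange_self h]

lemma hasFDerivAt_fderiv_transition {x₀ x₁ : M} {y : EuclideanSpace ℝ (Fin n)}
    (hy : y ∈ (extChartAt (𝓡 n) x₀).target)
    (h : (extChartAt (𝓡 n) x₀).symm y ∈ (extChartAt (𝓡 n) x₁).source) :
    HasFDerivAt (fderiv ℝ (transition x₀ x₁)) (fderiv ℝ (fderiv ℝ (transition x₀ x₁)) y) y :=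
  (((contDiffAt_transition hy h).fderiv_right (m := ∞) (by simp)).differentiableAt
    (by simp)).hasFDerivAt

/-- The transformation law of the Christoffel symbols. -/
lemma fderiv_transition_chartChristoffel (g : Metric n M) {x₀ x₁ : M}
    {y : EuclideanSpace ℝ (Fin n)} (hy : y ∈ (extChartAt (𝓡 n) x₀).target)
    (h : (extChartAt (𝓡 n) x₀).symm y ∈ (extChartAt (𝓡 n) x₁).source)
    (u v : EuclideanSpace ℝ (Fin n)) :
    fderiv ℝ (transition x₀ x₁) y (chartChristoffel g x₀ y u v)
      = fderiv ℝ (fderiv ℝ (transition x₀ x₁)) y u v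
        + chartChristoffel g x₁ (transition x₀ x₁ y) (fderiv ℝ (transition x₀ x₁) y u)
          (fderiv ℝ (transition x₀ x₁) y v) := by
  have hψy : transition x₀ x₁ y ∈ (extChartAt (𝓡 n) x₁).target :=
    (extChartAt (𝓡 n) x₁).map_source h
  set ψ : EuclideanSpace ℝ (Fin n) → EuclideanSpace ℝ (Fin n) := transition x₀ x₁ with hψ
  set L := fderiv ℝ ψ y with hL
  set H := fderiv ℝ (fderiv ℝ ψ) y with hH
  have hLd : HasFDerivAt ψ L y :=
    ((contDiffAt_transition hy h).differentiableAt (by simp)).hasFDerivAt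
  have hHd : HasFDerivAt (fderiv ℝ ψ) H y := hasFDerivAt_fderiv_transition hy h
  have hHs : ∀ u v, H u v = H v u := by
    intro u v
    have : IsSymmSndFDerivAt ℝ ψ y := (contDiffAt_transition hy h).isSymmSndFDerivAt
      (by simpa using (ENat.LEInfty.out : (2 : WithTop ℕ∞) ≤ ∞))
    exact this u v
  -- differentiate the equation that expresses the first metric through the second
  have hD : ∀ u v w, fderiv ℝ (chartMetric g x₀) y u v w
      = fderiv ℝ (chartMetric g x₁) (ψ y) (L u) (L v) (L w)
        + chartMetric g x₁ (ψ y) (H u v) (L w) + chartMetric g x₁ (ψ y) (L v) (H u w) := by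
    intro u v w
    have h1 := hasFDerivAt_chartMetric_apply g hy v w
    obtain ⟨T, hT, hTu⟩ := exists_hasFDerivAt_bilin (hasFDerivAt_chartMetric g hψy) hLd
      (hHd.clm_apply (hasFDerivAt_const v y)) (hHd.clm_apply (hasFDerivAt_const w y))
    have h3 := h1.unique (hT.congr_of_eventuallyEq ?_)
    · have h4 : fderiv ℝ (chartMetric g x₀) y u v w = T u := congrArg (fun T => T u) h3
      rw [h4, hTu]
      simp [hL]
    · filter_upwards [eventually_symm_mem_source hy h] with z hz
      exact chartMetric_transition g hz.1 hz.2 v w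
  refine chartMetric_ext g hψy fun z => ?_
  obtain ⟨w, rfl⟩ := fderiv_transition_surjective hy h z
  have e1 := chartMetric_transition g hy h (chartChristoffel g x₀ y u v) w
  rw [← hψ, ← hL] at e1
  have e2 := koszul g hy u v w
  have e3 := koszul g hψy (L u) (L v) (L w)
  rw [hD, hD, hD] at e2
  rw [map_add, add_apply, ← e1]
  have s1 := hHs u w
  have s2 := hHs v w
  have s3 := hHs u v
  rw [s1, s2, ← s3] at e2
  linarith [chartMetric_symm g x₁ (ψ y) (L v) (H w u), chartMetric_symm g x₁ (ψ y) (L u) (H w v)]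

end Christoffel

/-! ### The covariant derivative along a map -/

section CovariantDerivative

variable {n : ℕ} {M : Type*} [TopologicalSpace M]
  [ChartedSpace (EuclideanSpace ℝ (Fin n)) M]
  {P : Type*} [NormedAddCommGroup P] [NormedSpace ℝ P]

lemma eventually_mem_source {F : P → M} (hF : ContMDiff 𝓘(ℝ, P) (𝓡 n) ∞ F) {q : P} {x₀ : M}
    (h : F q ∈ (extChartAt (𝓡 n) x₀).source) :
    ∀ᶠ q' in 𝓝 q, F q' ∈ (extChartAt (𝓡 n) x₀).source :=
  hF.continuous.continuousAt.eventually ((isOpen_extChartAt_source x₀).mem_nhds h)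

/-- The derivative of `F : P → M` at `q` in the direction `w`. -/
def velDir (F : P → M) (w : P) (q : P) : EuclideanSpace ℝ (Fin n) :=
  fderiv ℝ (fun q' => extChartAt (𝓡 n) (F q) (F q')) q w

variable [IsManifold (𝓡 n) ∞ M]

/-- The covariant derivative in the direction `w` of a vector field `X` along `F : P → M`.
The values of `X` are tangent vectors `X q` at `F q`, written in the preferred chart at `F q`. -/
def covDir (g : Metric n M) (F : P → M) (X : P → EuclideanSpace ℝ (Fin n)) (w : P) (q : P) :
    EuclideanSpace ℝ (Fin n) :=
  fderiv ℝ (fun q' => toChart (F q) (F q') (X q')) q w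
    + chartChristoffel g (F q) (extChartAt (𝓡 n) (F q) (F q)) (velDir F w q) (X q)

/-- Smoothness at `q` of a vector field along `F`. -/
def FieldSmoothAt (F : P → M) (X : P → EuclideanSpace ℝ (Fin n)) (q : P) : Prop :=
  ContDiffAt ℝ ∞ (fun q' => toChart (F q) (F q') (X q')) q

variable {g : Metric n M} {F : P → M} {X Y : P → EuclideanSpace ℝ (Fin n)} {q : P}

lemma contDiffAt_extChartAt_comp (hF : ContMDiff 𝓘(ℝ, P) (𝓡 n) ∞ F) {x₀ : M}
    (h : F q ∈ (extChartAt (𝓡 n) x₀).source) :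
    ContDiffAt ℝ ∞ (fun q' => extChartAt (𝓡 n) x₀ (F q')) q := by
  rw [← contMDiffAt_iff_contDiffAt]
  exact (contMDiffAt_extChartAt' (by rwa [extChartAt_source] at h)).comp q hF.contMDiffAt

lemma eventually_toChart_eq (hF : ContMDiff 𝓘(ℝ, P) (𝓡 n) ∞ F) {x₀ x₁ : M}
    (h₀ : F q ∈ (extChartAt (𝓡 n) x₀).source) (h₁ : F q ∈ (extChartAt (𝓡 n) x₁).source)
    (X : P → EuclideanSpace ℝ (Fin n)) :
    (fun q' => toChart x₁ (F q') (X q')) =ᶠ[𝓝 q] fun q' =>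
      fderiv ℝ (transition x₀ x₁) (extChartAt (𝓡 n) x₀ (F q')) (toChart x₀ (F q') (X q')) := by
  filter_upwards [eventually_mem_source hF h₀, eventually_mem_source hF h₁] with q' h h'
  exact (fderiv_transition_toChart h h' _).symm

lemma toChart_velDir (hF : ContMDiff 𝓘(ℝ, P) (𝓡 n) ∞ F) {x₀ : M}
    (h₀ : F q ∈ (extChartAt (𝓡 n) x₀).source) (w : P) :
    toChart x₀ (F q) (velDir F w q)
      = fderiv ℝ (fun q' => extChartAt (𝓡 n) x₀ (F q')) q w := by
  have hs := mem_extChartAt_source (I := 𝓡 n) (F q)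
  have hev : (fun q' => extChartAt (𝓡 n) x₀ (F q')) =ᶠ[𝓝 q]
      fun q' => transition (F q) x₀ (extChartAt (𝓡 n) (F q) (F q')) := by
    filter_upwards [eventually_mem_source hF hs] with q' h
    rw [transition, (extChartAt (𝓡 n) (F q)).left_inv h]
  have h1 := (contDiffAt_transition (x₁ := x₀) ((extChartAt (𝓡 n) (F q)).map_source hs)
    (by rwa [(extChartAt (𝓡 n) (F q)).left_inv hs])).differentiableAt (by simp)
  have h2 := (contDiffAt_extChartAt_comp hF hs).differentiableAt (by simp)
  have h3 : HasFDerivAt (fun q' => transition (F q) x₀ (extChartAt (𝓡 n) (F q) (F q'))) _ q :=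
    HasFDerivAt.comp (g := transition (F q) x₀) q h1.hasFDerivAt h2.hasFDerivAt
  rw [hev.fderiv_eq, h3.fderiv, velDir,
    ← fderiv_transition_toChart hs h₀, toChart_self]
  rfl

lemma fderiv_congr_toChart (hF : ContMDiff 𝓘(ℝ, P) (𝓡 n) ∞ F) {x₀ x₁ : M}
    (h₀ : F q ∈ (extChartAt (𝓡 n) x₀).source) (h₁ : F q ∈ (extChartAt (𝓡 n) x₁).source)
    (hX : ContDiffAt ℝ ∞ (fun q' => toChart x₀ (F q') (X q')) q) (w : P) :
    fderiv ℝ (fun q' => toChart x₁ (F q') (X q')) q w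
      = fderiv ℝ (fderiv ℝ (transition x₀ x₁)) (extChartAt (𝓡 n) x₀ (F q))
          (fderiv ℝ (fun q' => extChartAt (𝓡 n) x₀ (F q')) q w) (toChart x₀ (F q) (X q))
        + fderiv ℝ (transition x₀ x₁) (extChartAt (𝓡 n) x₀ (F q))
          (fderiv ℝ (fun q' => toChart x₀ (F q') (X q')) q w) := by
  have h1 := hasFDerivAt_fderiv_transition (x₁ := x₁) ((extChartAt (𝓡 n) x₀).map_source h₀)
    (by rwa [(extChartAt (𝓡 n) x₀).left_inv h₀])
  have h2 := ((contDiffAt_extChartAt_comp hF h₀).differentiableAt (by simp)).hasFDerivAt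
  have h3 := (hX.differentiableAt (by simp)).hasFDerivAt
  have h4 : HasFDerivAt (fun q' => fderiv ℝ (transition x₀ x₁) (extChartAt (𝓡 n) x₀ (F q')))
    _ q := h1.comp q h2
  rw [(eventually_toChart_eq hF h₀ h₁ X).fderiv_eq, (h4.clm_apply h3).fderiv, add_comm]
  rfl

/-- The coordinate expression of the covariant derivative, in an arbitrary chart. -/
lemma toChart_covDir (g : Metric n M) (hF : ContMDiff 𝓘(ℝ, P) (𝓡 n) ∞ F)
    (hX : FieldSmoothAt F X q) {x₀ : M} (h₀ : F q ∈ (extChartAt (𝓡 n) x₀).source) (w : P) :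
    toChart x₀ (F q) (covDir g F X w q)
      = fderiv ℝ (fun q' => toChart x₀ (F q') (X q')) q w
        + chartChristoffel g x₀ (extChartAt (𝓡 n) x₀ (F q))
          (fderiv ℝ (fun q' => extChartAt (𝓡 n) x₀ (F q')) q w) (toChart x₀ (F q) (X q)) := by
  have hs := mem_extChartAt_source (I := 𝓡 n) (F q)
  have ht := (extChartAt (𝓡 n) (F q)).map_source hs
  have hs' : (extChartAt (𝓡 n) (F q)).symm (extChartAt (𝓡 n) (F q) (F q))
      ∈ (extChartAt (𝓡 n) x₀).source := by rwa [(extChartAt (𝓡 n) (F q)).left_inv hs]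
  have hy : transition (F q) x₀ (extChartAt (𝓡 n) (F q) (F q)) = extChartAt (𝓡 n) x₀ (F q) := by
    rw [transition, (extChartAt (𝓡 n) (F q)).left_inv hs]
  rw [fderiv_congr_toChart hF hs h₀ hX, ← toChart_velDir hF h₀, ← fderiv_transition_toChart hs h₀,
    ← fderiv_transition_toChart hs h₀, ← fderiv_transition_toChart hs h₀, toChart_self,
    toChart_self, toChart_self, covDir, map_add, fderiv_transition_chartChristoffel g ht hs', hy,
    velDir]
  abel

lemma FieldSmoothAt.velDir (hF : ContMDiff 𝓘(ℝ, P) (𝓡 n) ∞ F) (w : P) (q : P) :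
    FieldSmoothAt (n := n) F (velDir F w) q := by
  have hs := mem_extChartAt_source (I := 𝓡 n) (F q)
  have h : ContDiffAt ℝ ∞ (fun q' => fderiv ℝ (fun q' => extChartAt (𝓡 n) (F q) (F q')) q' w) q :=
    ((contDiffAt_extChartAt_comp hF hs).fderiv_right (m := ∞) (by simp)).clm_apply contDiffAt_const
  refine h.congr_of_eventuallyEq ?_
  filter_upwards [eventually_mem_source hF hs] with q' h'
  exact toChart_velDir hF h' w

lemma FieldSmoothAt.covDir (g : Metric n M) (hF : ContMDiff 𝓘(ℝ, P) (𝓡 n) ∞ F)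
    (hX : ∀ᶠ q' in 𝓝 q, FieldSmoothAt F X q') (w : P) : FieldSmoothAt F (covDir g F X w) q := by
  have hs := mem_extChartAt_source (I := 𝓡 n) (F q)
  have hu := contDiffAt_extChartAt_comp hF hs
  have hξ : ContDiffAt ℝ ∞ _ q := hX.self_of_nhds
  have hC : ContDiffAt ℝ ∞
      (fun q' => chartChristoffel g (F q) (extChartAt (𝓡 n) (F q) (F q'))) q :=
    ContDiffAt.comp (g := chartChristoffel g (F q)) q
      (contDiffAt_chartChristoffel g ((extChartAt (𝓡 n) (F q)).map_source hs)) hu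
  have h := ((hξ.fderiv_right (m := ∞) (by simp)).clm_apply (contDiffAt_const (c := w))).add
    ((hC.clm_apply ((hu.fderiv_right (m := ∞) (by simp)).clm_apply
      (contDiffAt_const (c := w)))).clm_apply hξ)
  refine h.congr_of_eventuallyEq ?_
  filter_upwards [eventually_mem_source hF hs, hX] with q' h' h''
  exact toChart_covDir g hF h'' h' w

lemma FieldSmoothAt.add (hX : FieldSmoothAt F X q) (hY : FieldSmoothAt F Y q) :
    FieldSmoothAt F (fun q' => X q' + Y q') q := by
  unfold FieldSmoothAt at *
  simp only [map_add]
  exact ContDiffAt.add hX hY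

lemma FieldSmoothAt.smul {f : P → ℝ} (hf : ContDiffAt ℝ ∞ f q) (hX : FieldSmoothAt F X q) :
    FieldSmoothAt F (fun q' => f q' • X q') q := by
  unfold FieldSmoothAt at *
  simp only [map_smul]
  exact ContDiffAt.smul hf hX

lemma covDir_congr (h : X =ᶠ[𝓝 q] Y) (w : P) : covDir g F X w q = covDir g F Y w q := by
  have h1 : (fun q' => toChart (F q) (F q') (X q')) =ᶠ[𝓝 q]
    fun q' => toChart (F q) (F q') (Y q') := h.mono fun q' h' => by simp only [h']
  rw [covDir, covDir, h1.fderiv_eq, h.self_of_nhds]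

lemma covDir_add (hX : FieldSmoothAt F X q) (hY : FieldSmoothAt F Y q) (w : P) :
    covDir g F (fun q' => X q' + Y q') w q = covDir g F X w q + covDir g F Y w q := by
  have h1 := (ContDiffAt.differentiableAt hX (by simp)).hasFDerivAt
  have h2 := (ContDiffAt.differentiableAt hY (by simp)).hasFDerivAt
  have h3 : HasFDerivAt (fun q' => toChart (F q) (F q') (X q' + Y q')) _ q :=
    (h1.add h2).congr_of_eventuallyEq (Eventually.of_forall fun q' => map_add _ _ _)
  simp only [covDir, map_add]
  rw [← add_add_add_comm]
  congr 1
  simp only [map_add] at h3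
  rw [h3.fderiv]
  rfl

lemma covDir_smul {f : P → ℝ} (hf : ContDiffAt ℝ ∞ f q) (hX : FieldSmoothAt F X q) (w : P) :
    covDir g F (fun q' => f q' • X q') w q
      = fderiv ℝ f q w • X q + f q • covDir g F X w q := by
  have h1 := (ContDiffAt.differentiableAt hX (by simp)).hasFDerivAt
  have h2 := (hf.differentiableAt (by simp)).hasFDerivAt
  simp only [covDir, map_smul]
  have h3 : HasFDerivAt (fun q' => f q' • toChart (F q) (F q') (X q')) _ q := h2.smul h1
  rw [h3.fderiv]
  simp only [add_apply, smul_apply, ContinuousLinearMap.smulRight_apply, toChart_self, smul_add]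
  abel

lemma contDiffAt_metric (g : Metric n M) (hF : ContMDiff 𝓘(ℝ, P) (𝓡 n) ∞ F)
    (hX : FieldSmoothAt F X q) (hY : FieldSmoothAt F Y q) :
    ContDiffAt ℝ ∞ (fun q' => metric g (F q') (X q') (Y q')) q := by
  have hs := mem_extChartAt_source (I := 𝓡 n) (F q)
  have hG : ContDiffAt ℝ ∞ (fun q' => chartMetric g (F q) (extChartAt (𝓡 n) (F q) (F q'))) q :=
    ContDiffAt.comp (g := chartMetric g (F q)) q
      (contDiffAt_chartMetric g ((extChartAt (𝓡 n) (F q)).map_source hs))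
      (contDiffAt_extChartAt_comp hF hs)
  refine ((hG.clm_apply hX).clm_apply hY).congr_of_eventuallyEq ?_
  filter_upwards [eventually_mem_source hF hs] with q' h
  exact metric_eq_chartMetric g h _ _

/-- The metric is parallel. -/
lemma fderiv_metric (g : Metric n M) (hF : ContMDiff 𝓘(ℝ, P) (𝓡 n) ∞ F)
    (hX : FieldSmoothAt F X q) (hY : FieldSmoothAt F Y q) (w : P) :
    fderiv ℝ (fun q' => metric g (F q') (X q') (Y q')) q w
      = metric g (F q) (covDir g F X w q) (Y q) + metric g (F q) (X q) (covDir g F Y w q) := by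
  have hs := mem_extChartAt_source (I := 𝓡 n) (F q)
  have ht := (extChartAt (𝓡 n) (F q)).map_source hs
  have hev : (fun q' => metric g (F q') (X q') (Y q')) =ᶠ[𝓝 q] fun q' =>
      chartMetric g (F q) (extChartAt (𝓡 n) (F q) (F q')) (toChart (F q) (F q') (X q'))
        (toChart (F q) (F q') (Y q')) := by
    filter_upwards [eventually_mem_source hF hs] with q' h
    exact metric_eq_chartMetric g h _ _
  obtain ⟨T, hT, hTw⟩ := exists_hasFDerivAt_bilin (hasFDerivAt_chartMetric g ht)
    (ψ := fun q' => extChartAt (𝓡 n) (F q) (F q')) (y := q)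
    ((contDiffAt_extChartAt_comp hF hs).differentiableAt (by simp)).hasFDerivAt
    (ContDiffAt.differentiableAt hX (by simp)).hasFDerivAt
    (ContDiffAt.differentiableAt hY (by simp)).hasFDerivAt
  rw [hev.fderiv_eq, hT.fderiv, hTw, fderiv_chartMetric g ht, metric_eq_chartMetric g hs,
    metric_eq_chartMetric g hs, toChart_self, toChart_self, toChart_self, toChart_self, covDir,
    covDir, map_add, map_add, add_apply]
  simp only [velDir]
  ring

/-- The torsion-freeness of the connection: mixed covariant derivatives of a map commute. -/
lemma covDir_velDir_comm (g : Metric n M) (hF : ContMDiff 𝓘(ℝ, P) (𝓡 n) ∞ F) (v w q : P) :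
    covDir g F (velDir F v) w q = covDir g F (velDir F w) v q := by
  have hs := mem_extChartAt_source (I := 𝓡 n) (F q)
  have ht := (extChartAt (𝓡 n) (F q)).map_source hs
  have key : ∀ v, (fun q' => toChart (F q) (F q') (velDir F v q')) =ᶠ[𝓝 q]
      fun q' => fderiv ℝ (fun q' => extChartAt (𝓡 n) (F q) (F q')) q' v := by
    intro v
    filter_upwards [eventually_mem_source hF hs] with q' h
    exact toChart_velDir hF h v
  have hu := contDiffAt_extChartAt_comp hF hs
  have hd : ∀ v w, fderiv ℝ (fun q' => fderiv ℝ (fun q' => extChartAt (𝓡 n) (F q) (F q')) q' v) q w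
      = fderiv ℝ (fderiv ℝ (fun q' => extChartAt (𝓡 n) (F q) (F q'))) q w v := by
    intro v w
    have h := ((hu.fderiv_right (m := ∞) (by simp)).differentiableAt (by simp)).hasFDerivAt
    rw [(h.clm_apply (hasFDerivAt_const v q)).fderiv]
    simp
  have hsymm : IsSymmSndFDerivAt ℝ (fun q' => extChartAt (𝓡 n) (F q) (F q')) q :=
    hu.isSymmSndFDerivAt (by simpa using (ENat.LEInfty.out : (2 : WithTop ℕ∞) ≤ ∞))
  rw [covDir, covDir, (key v).fderiv_eq, (key w).fderiv_eq, hd, hd, hsymm w v,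
    chartChristoffel_symm g ht]

end CovariantDerivative

/-! ### Curvature -/

section Curvature

/-- A curvature-like tensor whose sectional curvatures all vanish is zero. -/
lemma eq_zero_of_curvatureLike {E : Type*} [AddCommGroup E] {S : E → E → E → E → ℝ}
    (add₁ : ∀ x x' y z w, S (x + x') y z w = S x y z w + S x' y z w)
    (add₂ : ∀ x y y' z w, S x (y + y') z w = S x y z w + S x y' z w)
    (add₃ : ∀ x y z z' w, S x y (z + z') w = S x y z w + S x y z' w)
    (add₄ : ∀ x y z w w', S x y z (w + w') = S x y z w + S x y z w')
    (anti₁₂ : ∀ x y z w, S x y z w = -S y x z w)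
    (bianchi : ∀ x y z w, S x y z w + S y z x w + S z x y w = 0)
    (skew : ∀ x y z, S x y z z = 0) (sec : ∀ x y, S x y y x = 0) (x y z w : E) :
    S x y z w = 0 := by
  have anti₃₄ : ∀ x y z w, S x y z w = -S x y w z := by
    intro x y z w
    have h := skew x y (z + w)
    rw [add₃, add₄, add₄, skew, skew] at h
    linarith
  have pair : ∀ x y z w, S x y z w = S z w x y := by
    intro x y z w
    linarith [bianchi x y z w, bianchi y z w x, bianchi z w x y, bianchi w x y z,
      anti₁₂ x y z w, anti₃₄ x y z w, anti₃₄ y z x w, anti₃₄ z x y w, anti₃₄ y z w x,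
      anti₃₄ z w y x, anti₃₄ w y z x, anti₃₄ z w x y, anti₃₄ w x z y, anti₃₄ x z w y,
      anti₃₄ w x y z, anti₃₄ x y w z, anti₃₄ y w x z, anti₁₂ z x y w, anti₁₂ w y z x,
      anti₁₂ x z w y, anti₁₂ y w x z]
  -- polarization of `sec` in the outer arguments, then of the result in the inner ones
  have sec' : ∀ x y w, S x y y w = 0 := by
    intro x y w
    have h := sec (x + w) y
    rw [add₁, add₄, add₄, sec, sec] at h
    linarith [pair w y y x, anti₁₂ y x w y, anti₃₄ x y w y]
  have anti₂₃ : ∀ x y z w, S x y z w = -S x z y w := by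
    intro x y z w
    have h := sec' x (y + z) w
    rw [add₂, add₃, add₃, sec', sec'] at h
    linarith
  linarith [bianchi x y z w, anti₂₃ y z x w, anti₁₂ y x z w, anti₁₂ z x y w, anti₂₃ x z y w]

variable {n : ℕ} {M : Type*} [TopologicalSpace M]
  [ChartedSpace (EuclideanSpace ℝ (Fin n)) M] [IsManifold (𝓡 n) ∞ M]

/-- The Riemann curvature tensor, as a function on the model space. -/
def curv (g : Metric n M) (x : M) (X Y Z : EuclideanSpace ℝ (Fin n)) : EuclideanSpace ℝ (Fin n) :=
  curvature g x X Y Z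

lemma hasFDerivAt_chartChristoffel (g : Metric n M) {x₀ : M} {y : EuclideanSpace ℝ (Fin n)}
    (hy : y ∈ (extChartAt (𝓡 n) x₀).target) :
    HasFDerivAt (chartChristoffel g x₀) (fderiv ℝ (chartChristoffel g x₀) y) y :=
  ((contDiffAt_chartChristoffel g hy).differentiableAt (by simp)).hasFDerivAt

lemma fderiv_chartChristoffel_apply (g : Metric n M) {x₀ : M} {y : EuclideanSpace ℝ (Fin n)}
    (hy : y ∈ (extChartAt (𝓡 n) x₀).target) (u v w : EuclideanSpace ℝ (Fin n)) :
    fderiv ℝ (fun z => chartChristoffel g x₀ z v w) y u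
      = fderiv ℝ (chartChristoffel g x₀) y u v w := by
  rw [(((hasFDerivAt_chartChristoffel g hy).clm_apply (hasFDerivAt_const v y)).clm_apply
    (hasFDerivAt_const w y)).fderiv]
  simp

lemma curv_eq (g : Metric n M) (x : M) (X Y Z : EuclideanSpace ℝ (Fin n)) :
    curv g x X Y Z
      = fderiv ℝ (chartChristoffel g x) (extChartAt (𝓡 n) x x) X Y Z
        - fderiv ℝ (chartChristoffel g x) (extChartAt (𝓡 n) x x) Y X Z
        + chartChristoffel g x (extChartAt (𝓡 n) x x) X
          (chartChristoffel g x (extChartAt (𝓡 n) x x) Y Z)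
        - chartChristoffel g x (extChartAt (𝓡 n) x x) Y
          (chartChristoffel g x (extChartAt (𝓡 n) x x) X Z) := by
  have ht := mem_extChartAt_target (I := 𝓡 n) x
  rw [← fderiv_chartChristoffel_apply g ht, ← fderiv_chartChristoffel_apply g ht]
  simp only [chartChristoffel_apply]
  rfl

lemma curv_anti (g : Metric n M) (x : M) (X Y Z : EuclideanSpace ℝ (Fin n)) :
    curv g x X Y Z = -curv g x Y X Z := by
  rw [curv_eq, curv_eq]
  abel

lemma curv_bianchi (g : Metric n M) (x : M) (X Y Z : EuclideanSpace ℝ (Fin n)) :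
    curv g x X Y Z + curv g x Y Z X + curv g x Z X Y = 0 := by
  have ht := mem_extChartAt_target (I := 𝓡 n) x
  have hC := chartChristoffel_symm g ht
  have hD : ∀ u v w, fderiv ℝ (chartChristoffel g x) (extChartAt (𝓡 n) x x) u v w
      = fderiv ℝ (chartChristoffel g x) (extChartAt (𝓡 n) x x) u w v := by
    intro u v w
    rw [← fderiv_chartChristoffel_apply g ht, ← fderiv_chartChristoffel_apply g ht]
    have hev : (fun z => chartChristoffel g x z v w) =ᶠ[𝓝 (extChartAt (𝓡 n) x x)]
        fun z => chartChristoffel g x z w v := by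
      filter_upwards [(isOpen_extChartAt_target (I := 𝓡 n) x).mem_nhds ht] with z hz
      exact chartChristoffel_symm g hz v w
    rw [hev.fderiv_eq]
  rw [curv_eq, curv_eq, curv_eq, hD X Z Y, hD Y X Z, hD Z Y X, hC X Z, hC Y X, hC Z Y]
  abel

lemma metric_curv_self (g : Metric n M) (x : M) (X Y Z : EuclideanSpace ℝ (Fin n)) :
    metric g x (curv g x X Y Z) Z = 0 := by
  have ht := mem_extChartAt_target (I := 𝓡 n) x
  have hs := mem_extChartAt_source (I := 𝓡 n) x
  set y := extChartAt (𝓡 n) x x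
  set G := chartMetric g x
  set C := chartChristoffel g x
  -- twice the second derivative of the squared length of the constant field `Z`
  have h2 : ∀ u v, fderiv ℝ (fderiv ℝ (fun z => G z Z Z)) y v u
      = 2 * (G y (C y v (C y u Z)) Z + G y (C y u Z) (C y v Z)
        + G y (fderiv ℝ C y v u Z) Z) := by
    intro u v
    have hsm : ContDiffAt ℝ ∞ (fun z => G z Z Z) y :=
      ((contDiffAt_chartMetric g ht).clm_apply contDiffAt_const).clm_apply contDiffAt_const
    have h0 := ((hsm.fderiv_right (m := ∞) (by simp)).differentiableAt (by simp)).hasFDerivAt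
    have h1 := h0.clm_apply (hasFDerivAt_const u y)
    have hev : (fun z => fderiv ℝ (fun z => G z Z Z) z u) =ᶠ[𝓝 y]
        fun z => G z (C z u Z) ((2 : ℝ) • Z) := by
      filter_upwards [(isOpen_extChartAt_target x).mem_nhds ht] with z hz
      rw [(hasFDerivAt_chartMetric_apply g hz Z Z).fderiv]
      change fderiv ℝ (chartMetric g x) z u Z Z = _
      rw [fderiv_chartMetric g hz, chartMetric_symm g x z Z, map_smul, smul_eq_mul, two_mul]
    obtain ⟨T, hT, hTu⟩ := exists_hasFDerivAt_bilin (ψ := fun z => z) (y := y)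
      (hasFDerivAt_chartMetric g ht) (hasFDerivAt_id y)
        (((hasFDerivAt_chartChristoffel g ht).clm_apply (hasFDerivAt_const u y)).clm_apply
        (hasFDerivAt_const Z y))
        (hasFDerivAt_const ((2 : ℝ) • Z) y)
    have h3 := h1.unique (hT.congr_of_eventuallyEq hev)
    have h4 := congrArg (fun T => T v) h3
    simp only [hTu] at h4
    simp at h4
    rw [fderiv_chartMetric g ht] at h4
    linarith
  have hsymm : IsSymmSndFDerivAt ℝ (fun z => G z Z Z) y :=
    ContDiffAt.isSymmSndFDerivAt (n := ∞)
      (((contDiffAt_chartMetric g ht).clm_apply contDiffAt_const).clm_apply contDiffAt_const)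
      (by simpa using (ENat.LEInfty.out : (2 : WithTop ℕ∞) ≤ ∞))
  have h := hsymm X Y
  rw [h2, h2] at h
  rw [metric_eq_chartMetric g hs, toChart_self, toChart_self, curv_eq, map_sub, map_add, map_sub]
  simp only [sub_apply, add_apply]
  have := chartMetric_symm g x y (C y X Z) (C y Y Z)
  change G y _ _ - G y _ _ + G y _ _ - G y _ _ = 0
  change G y (C y X Z) (C y Y Z) = G y (C y Y Z) (C y X Z) at this
  linarith

lemma metric_curv (g : Metric n M) {K : ℝ} (hK : HasConstantCurvature g K) (x : M)
    (X Y Z W : EuclideanSpace ℝ (Fin n)) :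
    metric g x (curv g x X Y Z) W
      = K * (metric g x Y Z * metric g x X W - metric g x X Z * metric g x Y W) := by
  have h := eq_zero_of_curvatureLike (S := fun X Y Z W => metric g x (curv g x X Y Z) W
      - K * (metric g x Y Z * metric g x X W - metric g x X Z * metric g x Y W))
    ?_ ?_ ?_ ?_ ?_ ?_ ?_ ?_ X Y Z W
  · linarith
  · intro x₁ x₂ y z w
    have : curv g x (x₁ + x₂) y z = curv g x x₁ y z + curv g x x₂ y z := by
      simp only [curv_eq, map_add, add_apply]; abel
    simp only [this, metric_add_left]; ring
  · intro x₁ y y' z w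
    have : curv g x x₁ (y + y') z = curv g x x₁ y z + curv g x x₁ y' z := by
      simp only [curv_eq, map_add, add_apply]; abel
    simp only [this, metric_add_left]; ring
  · intro x₁ y z z' w
    have : curv g x x₁ y (z + z') = curv g x x₁ y z + curv g x x₁ y z' := by
      simp only [curv_eq, map_add]; abel
    simp only [this, metric_add_left, metric_add_right]; ring
  · intro x₁ y z w w'
    simp only [metric_add_right]; ring
  · intro x₁ y z w
    have : curv g x x₁ y z = (-1 : ℝ) • curv g x y x₁ z := by rw [curv_anti]; simp
    simp only [this, metric_smul_left]; ring
  · intro x₁ y z w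
    have h := congrArg (fun v => metric g x v w) (curv_bianchi g x x₁ y z)
    have h0 : metric g x 0 w = 0 := by simpa using metric_smul_left g x 0 0 w
    simp only [metric_add_left, h0] at h
    have := metric_symm g x y x₁
    have := metric_symm g x z x₁
    have := metric_symm g x z y
    simp only [*]
    linear_combination h
  · intro x₁ y z
    simp only [metric_curv_self]; ring
  · intro x₁ y
    have h : metric g x (curv g x x₁ y y) x₁
      = K * (metric g x x₁ x₁ * metric g x y y - metric g x x₁ y ^ 2) := hK x x₁ y
    simp only [h, metric_symm g x y x₁]; ring

/-- In constant curvature, `R(X, Y)Z` is an explicit combination of `X` and `Y`. -/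
lemma curv_eq_of_hasConstantCurvature (g : Metric n M) {K : ℝ} (hK : HasConstantCurvature g K)
    (x : M) (X Y Z : EuclideanSpace ℝ (Fin n)) :
    curv g x X Y Z = (K * metric g x Y Z) • X + (-(K * metric g x X Z)) • Y := by
  by_contra hne
  have h := metric_pos g x (sub_ne_zero.2 hne)
  rw [sub_eq_add_neg, ← neg_one_smul ℝ (_ + _)] at h
  set D := curv g x X Y Z + (-1 : ℝ) • ((K * metric g x Y Z) • X + (-(K * metric g x X Z)) • Y)
  have h2 : metric g x D D = 0 := by
    conv_lhs => enter [3]; unfold D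
    simp only [metric_add_left, metric_smul_left, metric_curv g hK]
    ring
  linarith

variable {P : Type*} [NormedAddCommGroup P] [NormedSpace ℝ P] {F : P → M}
  {X : P → EuclideanSpace ℝ (Fin n)} {q : P}

/-- Up to a term that is symmetric in `v` and `w`, the second covariant derivative is given by the
Christoffel symbols and their first derivative. -/
lemma covDir_covDir (g : Metric n M) (hF : ContMDiff 𝓘(ℝ, P) (𝓡 n) ∞ F)
    (hX : ∀ᶠ q' in 𝓝 q, FieldSmoothAt F X q') :
    ∃ S : P → P → EuclideanSpace ℝ (Fin n), (∀ v w, S v w = S w v) ∧ ∀ v w,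
    covDir g F (covDir g F X w) v q = S v w
      + fderiv ℝ (chartChristoffel g (F q)) (extChartAt (𝓡 n) (F q) (F q))
        (velDir F v q) (velDir F w q) (X q)
      + chartChristoffel g (F q) (extChartAt (𝓡 n) (F q) (F q)) (velDir F v q)
        (chartChristoffel g (F q) (extChartAt (𝓡 n) (F q) (F q)) (velDir F w q) (X q)) := by
  have hs := mem_extChartAt_source (I := 𝓡 n) (F q)
  have ht := (extChartAt (𝓡 n) (F q)).map_source hs
  have hu := contDiffAt_extChartAt_comp hF hs
  have hξ : ContDiffAt ℝ ∞ _ q := hX.self_of_nhds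
  set u : P → EuclideanSpace ℝ (Fin n) := fun q' => extChartAt (𝓡 n) (F q) (F q') with hu'
  set ξ : P → EuclideanSpace ℝ (Fin n) := fun q' => toChart (F q) (F q') (X q') with hξ'
  set C := chartChristoffel g (F q) with hC
  have hξq : ξ q = X q := toChart_self _ _
  have hfu : HasFDerivAt (fderiv ℝ u) (fderiv ℝ (fderiv ℝ u) q) q :=
    ((hu.fderiv_right (m := ∞) (by simp)).differentiableAt (by simp)).hasFDerivAt
  have hfξ : HasFDerivAt (fderiv ℝ ξ) (fderiv ℝ (fderiv ℝ ξ) q) q :=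
    ((hξ.fderiv_right (m := ∞) (by simp)).differentiableAt (by simp)).hasFDerivAt
  have h2 : (2 : WithTop ℕ∞) ≤ ∞ := ENat.LEInfty.out
  have su : IsSymmSndFDerivAt ℝ u q := hu.isSymmSndFDerivAt (by simpa using h2)
  have sξ : IsSymmSndFDerivAt ℝ ξ q := hξ.isSymmSndFDerivAt (by simpa using h2)
  refine ⟨fun v w => fderiv ℝ (fderiv ℝ ξ) q v w + C (u q) (fderiv ℝ (fderiv ℝ u) q v w) (ξ q)
    + (C (u q) (fderiv ℝ u q w) (fderiv ℝ ξ q v) + C (u q) (fderiv ℝ u q v) (fderiv ℝ ξ q w)),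
    fun v w => ?_, fun v w => ?_⟩
  · simp only [su v w, sξ v w]
    abel
  · obtain ⟨T, hT, hTv⟩ := exists_hasFDerivAt_bilin (ψ := u) (y := q)
      (hasFDerivAt_chartChristoffel g ht) (hu.differentiableAt (by simp)).hasFDerivAt
      (hfu.clm_apply (hasFDerivAt_const w q)) (hξ.differentiableAt (by simp)).hasFDerivAt
    have hev : (fun q' => toChart (F q) (F q') (covDir g F X w q')) =ᶠ[𝓝 q]
        fun q' => fderiv ℝ ξ q' w + C (u q') (fderiv ℝ u q' w) (ξ q') := by
      filter_upwards [eventually_mem_source hF hs, hX] with q' h' h''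
      exact toChart_covDir g hF h'' h' w
    have h3 : HasFDerivAt (fun q' => fderiv ℝ ξ q' w + C (u q') (fderiv ℝ u q' w) (ξ q')) _ q :=
      (hfξ.clm_apply (hasFDerivAt_const w q)).add hT
    have h4 : fderiv ℝ (fun q' => toChart (F q) (F q') (covDir g F X w q')) q v
        = fderiv ℝ (fderiv ℝ ξ) q v w + T v := by
      rw [hev.fderiv_eq, h3.fderiv]
      simp
    have h5 : covDir g F X w q = fderiv ℝ ξ q w + C (u q) (fderiv ℝ u q w) (X q) := rfl
    rw [covDir, h4, hTv, h5, map_add, hξq]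
    simp only [velDir, hC, hu', add_apply, ContinuousLinearMap.comp_apply,
      ContinuousLinearMap.flip_apply, map_zero, zero_add, zero_apply]
    abel

/-- The Ricci identity. -/
lemma covDir_covDir_sub (g : Metric n M) (hF : ContMDiff 𝓘(ℝ, P) (𝓡 n) ∞ F)
    (hX : ∀ᶠ q' in 𝓝 q, FieldSmoothAt F X q') (v w : P) :
    covDir g F (covDir g F X w) v q - covDir g F (covDir g F X v) w q
      = curv g (F q) (velDir F v q) (velDir F w q) (X q) := by
  obtain ⟨S, hS, h⟩ := covDir_covDir g hF hX
  rw [h, h, hS v w, curv_eq]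
  abel

end Curvature

/-! ### Restriction to curves -/

section Slices

variable {n : ℕ} {M : Type*} [TopologicalSpace M]
  [ChartedSpace (EuclideanSpace ℝ (Fin n)) M]

lemma velDir_add_period {c : ℝ → M} {L : ℝ} (hc : ∀ s, c (s + L) = c s) (s : ℝ) :
    velDir (n := n) c (1 : ℝ) (s + L) = velDir c (1 : ℝ) s := by
  unfold velDir
  rw [hc, ← fderiv_comp_add_right]
  simp only [hc]

lemma velocity_eq_velDir {c : ℝ → M} (hc : ContMDiff 𝓘(ℝ, ℝ) (𝓡 n) ∞ c) (s : ℝ) :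
    velocity (n := n) c s = velDir c (1 : ℝ) s := by
  have h : MDifferentiableAt 𝓘(ℝ, ℝ) (𝓡 n) c s := hc.mdifferentiableAt (by simp)
  have h2 : velocity (n := n) c s
      = fderivWithin ℝ (writtenInExtChartAt 𝓘(ℝ, ℝ) (𝓡 n) s c) (range 𝓘(ℝ, ℝ))
        (extChartAt 𝓘(ℝ, ℝ) s s) 1 := congrArg (fun L => L (1 : ℝ)) h.mfderiv
  refine h2.trans ?_
  simp only [writtenInExtChartAt, velDir, Function.comp_def, modelWithCornersSelf_coe, range_id,
    fderivWithin_univ]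
  rfl

lemma contMDiff_slice {F : ℝ × ℝ → M} (hF : ContMDiff 𝓘(ℝ, ℝ × ℝ) (𝓡 n) ∞ F) {ι : ℝ → ℝ × ℝ}
    (hι : ContDiff ℝ ∞ ι) : ContMDiff 𝓘(ℝ, ℝ) (𝓡 n) ∞ (fun u => F (ι u)) :=
  hF.comp hι.contMDiff

variable [IsManifold (𝓡 n) ∞ M]
  {P : Type*} [NormedAddCommGroup P] [NormedSpace ℝ P]
  {g : Metric n M} {F : P → M} {X : P → EuclideanSpace ℝ (Fin n)}

lemma covDeriv_eq_covDir (g : Metric n M) {c : ℝ → M} (hc : ContMDiff 𝓘(ℝ, ℝ) (𝓡 n) ∞ c)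
    (X : ℝ → EuclideanSpace ℝ (Fin n)) (s : ℝ) :
    covDeriv g c X s = covDir g c X (1 : ℝ) s := by
  unfold covDir
  rw [chartChristoffel_apply, ← velocity_eq_velDir hc]
  rfl

lemma tension_eq_covDir (g : Metric n M) {c : ℝ → M} (hc : ContMDiff 𝓘(ℝ, ℝ) (𝓡 n) ∞ c) (s : ℝ) :
    tension g c s = covDir g c (velDir c (1 : ℝ)) (1 : ℝ) s := by
  rw [← covDeriv_eq_covDir g hc]
  unfold tension
  congr 1
  exact funext fun s => velocity_eq_velDir hc s

lemma velDir_comp (hF : ContMDiff 𝓘(ℝ, P) (𝓡 n) ∞ F) {ι : ℝ → P} {w : P} {s : ℝ}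
    (hι : HasDerivAt ι w s) :
    velDir (n := n) (fun u => F (ι u)) (1 : ℝ) s = velDir F w (ι s) := by
  have h := ((contDiffAt_extChartAt_comp hF
    (mem_extChartAt_source (I := 𝓡 n) (F (ι s)))).differentiableAt (by simp)).hasFDerivAt
  have h2 : HasDerivAt (fun u => extChartAt (𝓡 n) (F (ι s)) (F (ι u))) _ s :=
    h.comp_hasDerivAt s hι
  exact h2.deriv

lemma FieldSmoothAt.comp {ι : ℝ → P} (hι : ContDiff ℝ ∞ ι) {s : ℝ}
    (hX : FieldSmoothAt F X (ι s)) : FieldSmoothAt (fun u => F (ι u)) (fun u => X (ι u)) s :=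
  ContDiffAt.comp s hX hι.contDiffAt

lemma covDir_comp (hF : ContMDiff 𝓘(ℝ, P) (𝓡 n) ∞ F) {ι : ℝ → P} {w : P} {s : ℝ}
    (hι : HasDerivAt ι w s) (hX : FieldSmoothAt F X (ι s)) :
    covDir g (fun u => F (ι u)) (fun u => X (ι u)) (1 : ℝ) s = covDir g F X w (ι s) := by
  have h := (ContDiffAt.differentiableAt hX (by simp)).hasFDerivAt
  have h2 : HasDerivAt (fun u => toChart (F (ι s)) (F (ι u)) (X (ι u))) _ s :=
    h.comp_hasDerivAt s hι
  unfold covDir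
  rw [velDir_comp hF hι]
  congr 1
  exact h2.deriv

lemma covDir_add_period {c : ℝ → M} {X : ℝ → EuclideanSpace ℝ (Fin n)} {L : ℝ}
    (hc : ∀ s, c (s + L) = c s) (hX : ∀ s, X (s + L) = X s) (s : ℝ) :
    covDir g c X (1 : ℝ) (s + L) = covDir g c X (1 : ℝ) s := by
  unfold covDir
  rw [velDir_add_period hc, hc, hX, ← fderiv_comp_add_right]
  simp only [hc, hX]

end Slices

/-! ### Differentiation under the integral sign -/

section ParametricIntegral

/-- Differentiation under the integral sign over a compact interval. -/
lemma hasDerivAt_integral_of_continuousOn {f f' : ℝ × ℝ → ℝ} {U : Set (ℝ × ℝ)} (hU : IsOpen U)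
    (hf : ContinuousOn f U) (hf' : ContinuousOn f' U)
    (hd : ∀ q ∈ U, HasDerivAt (fun t => f (t, q.2)) (f' q) q.1) {a b t₀ : ℝ} (hab : a ≤ b)
    (h : ∀ s ∈ Icc a b, (t₀, s) ∈ U) :
    HasDerivAt (fun t => ∫ s in a..b, f (t, s)) (∫ s in a..b, f' (t₀, s)) t₀ := by
  obtain ⟨u, v, hu, -, htu, hv, huv⟩ := generalized_tube_lemma (isCompact_singleton (x := t₀))
    (isCompact_Icc (a := a) (b := b)) hU (by
      rintro ⟨t, s⟩ ⟨ht, hs⟩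
      rw [show t = t₀ from ht]
      exact h s hs)
  obtain ⟨ε, hε, hball⟩ := Metric.nhds_basis_closedBall.mem_iff.1
    (hu.mem_nhds (htu (mem_singleton t₀)))
  have hsub : Metric.closedBall t₀ ε ×ˢ Icc a b ⊆ U :=
    (prod_mono hball hv).trans huv
  obtain ⟨C, hC⟩ := ((isCompact_closedBall t₀ ε).prod isCompact_Icc).exists_bound_of_continuousOn
    (hf'.mono hsub)
  have hI : uIoc a b ⊆ Icc a b := by
    rw [uIoc_of_le hab]
    exact Ioc_subset_Icc_self
  have hslice : ∀ {φ : ℝ × ℝ → ℝ}, ContinuousOn φ U → ∀ t ∈ Metric.closedBall t₀ ε,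
      ContinuousOn (fun s => φ (t, s)) (Icc a b) := by
    intro φ hφ t ht
    exact hφ.comp (by fun_prop) fun s hs => hsub ⟨ht, hs⟩
  have hint : ∀ {φ : ℝ × ℝ → ℝ}, ContinuousOn φ U → ∀ t ∈ Metric.closedBall t₀ ε,
      IntervalIntegrable (fun s => φ (t, s)) MeasureTheory.volume a b := by
    intro φ hφ t ht
    refine ContinuousOn.intervalIntegrable ?_
    rw [uIcc_of_le hab]
    exact hslice hφ t ht
  have hmem : t₀ ∈ Metric.closedBall t₀ ε := Metric.mem_closedBall_self hε.le
  have hnhds := Metric.closedBall_mem_nhds t₀ hε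
  refine (intervalIntegral.hasDerivAt_integral_of_dominated_loc_of_deriv_le
    (F := fun t s => f (t, s)) (F' := fun t s => f' (t, s)) (bound := fun _ => C) hnhds ?_
    (hint hf t₀ hmem) ?_ ?_ intervalIntegrable_const ?_).2
  · filter_upwards [hnhds] with t ht
    exact (hint hf t ht).aestronglyMeasurable_restrict_uIoc
  · exact (hint hf' t₀ hmem).aestronglyMeasurable_restrict_uIoc
  · exact Eventually.of_forall fun s hs t ht => hC (t, s) ⟨ht, hI hs⟩
  · exact Eventually.of_forall fun s hs t ht => hd (t, s) (hsub ⟨ht, hI hs⟩)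

lemma eventually_forall_mem_of_isOpen {U : Set (ℝ × ℝ)} (hU : IsOpen U) {a b t₀ : ℝ}
    (h : ∀ s ∈ Icc a b, (t₀, s) ∈ U) : ∀ᶠ t in 𝓝 t₀, ∀ s ∈ Icc a b, (t, s) ∈ U := by
  obtain ⟨u, v, hu, -, htu, hv, huv⟩ := generalized_tube_lemma (isCompact_singleton (x := t₀))
    (isCompact_Icc (a := a) (b := b)) hU (by
      rintro ⟨t, s⟩ ⟨ht, hs⟩
      rw [show t = t₀ from ht]
      exact h s hs)
  filter_upwards [hu.mem_nhds (htu (mem_singleton t₀))] with t ht s hs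
  exact huv ⟨ht, hv hs⟩

end ParametricIntegral

/-! ### Variation of the tension field -/

section Variation

variable {n : ℕ} {M : Type*} [TopologicalSpace M]
  [ChartedSpace (EuclideanSpace ℝ (Fin n)) M] [IsManifold (𝓡 n) ∞ M]
  {P : Type*} [NormedAddCommGroup P] [NormedSpace ℝ P]
  {g : Metric n M} {F : P → M}

lemma FieldSmoothAt.covDir_of_forall (g : Metric n M) (hF : ContMDiff 𝓘(ℝ, P) (𝓡 n) ∞ F)
    {X : P → EuclideanSpace ℝ (Fin n)} (hX : ∀ q, FieldSmoothAt F X q) (w q : P) :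
    FieldSmoothAt F (PBiharmonic.covDir g F X w) q :=
  FieldSmoothAt.covDir g hF (Eventually.of_forall hX) w

/-- The Jacobi operator that gives the variation of the tension field. -/
lemma covDir_tension (g : Metric n M) (hF : ContMDiff 𝓘(ℝ, P) (𝓡 n) ∞ F) (ρ σ q : P) :
    covDir g F (covDir g F (velDir F σ) σ) ρ q
      = covDir g F (covDir g F (velDir F ρ) σ) σ q
        + curv g (F q) (velDir F ρ q) (velDir F σ q) (velDir F σ q) := by
  have h1 := covDir_covDir_sub g hF
    (Eventually.of_forall (f := 𝓝 q) (FieldSmoothAt.velDir hF σ)) ρ σ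
  have h2 : covDir g F (velDir F σ) ρ = covDir g F (velDir F ρ) σ :=
    funext fun q => covDir_velDir_comm g hF σ ρ q
  rw [h2] at h1
  rw [← h1]
  abel

/-- The second variation of the tension field in constant curvature `K`. Here `V` and `T` are the
derivatives of `F` in the directions `ρ` and `σ`, and `A` is the acceleration in the direction
`ρ`. -/
lemma covDir_covDir_tension (hF : ContMDiff 𝓘(ℝ, P) (𝓡 n) ∞ F) {K : ℝ}
    (hK : HasConstantCurvature g K) (ρ σ q : P) {V T DT DV A : EuclideanSpace ℝ (Fin n)}
    (hV : velDir F ρ q = V) (hT : velDir F σ q = T) (hDT : covDir g F (velDir F σ) σ q = DT)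
    (hDV : covDir g F (velDir F ρ) σ q = DV) (hA : covDir g F (velDir F ρ) ρ q = A) :
    covDir g F (covDir g F (covDir g F (velDir F σ) σ) ρ) ρ q
      = covDir g F (covDir g F (covDir g F (velDir F ρ) ρ) σ) σ q + curv g (F q) A T T
        + ((K * (metric g (F q) DT V + 4 * metric g (F q) T DV)) • V
          - (4 * (K * metric g (F q) V DV)) • T - (K * metric g (F q) V V) • DT) := by
  have sV := FieldSmoothAt.velDir (n := n) hF ρ
  have sT := FieldSmoothAt.velDir (n := n) hF σ
  have sDV := FieldSmoothAt.covDir_of_forall g hF sV σ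
  have sA := FieldSmoothAt.covDir_of_forall g hF sV ρ
  have comm : ∀ q, covDir g F (velDir F σ) ρ q = covDir g F (velDir F ρ) σ q :=
    covDir_velDir_comm g hF σ ρ
  have hDV' : covDir g F (velDir F σ) ρ q = DV := (comm q).trans hDV
  -- the covariant derivative of a multiple of a field by an inner product of two fields
  have key : ∀ {X Y Z : P → EuclideanSpace ℝ (Fin n)} (c : ℝ) (w : P),
      (∀ q, FieldSmoothAt F X q) → (∀ q, FieldSmoothAt F Y q) → (∀ q, FieldSmoothAt F Z q) →
      (∀ q, FieldSmoothAt F (fun q => (c * metric g (F q) (X q) (Y q)) • Z q) q) ∧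
      covDir g F (fun q => (c * metric g (F q) (X q) (Y q)) • Z q) w q
        = (c * (metric g (F q) (covDir g F X w q) (Y q)
            + metric g (F q) (X q) (covDir g F Y w q))) • Z q
          + (c * metric g (F q) (X q) (Y q)) • covDir g F Z w q := by
    intro X Y Z c w hX hY hZ
    have hm : ∀ q, ContDiffAt ℝ ∞ (fun q => c * metric g (F q) (X q) (Y q)) q := fun q =>
      contDiffAt_const.mul (contDiffAt_metric g hF (hX q) (hY q))
    refine ⟨fun q => (hZ q).smul (hm q), ?_⟩
    rw [covDir_smul (hm q) (hZ q), ← fderiv_metric g hF (hX q) (hY q),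
      fderiv_const_mul ((contDiffAt_metric g hF (hX q) (hY q)).differentiableAt (by simp))]
    rfl
  -- the first variation of the tension field
  have e1 : covDir g F (covDir g F (velDir F σ) σ) ρ = fun q =>
      covDir g F (covDir g F (velDir F ρ) σ) σ q
        + ((K * metric g (F q) (velDir F σ q) (velDir F σ q)) • velDir F ρ q
          + (-K * metric g (F q) (velDir F ρ q) (velDir F σ q)) • velDir F σ q) := by
    funext q
    rw [covDir_tension g hF, curv_eq_of_hasConstantCurvature g hK, neg_mul]
  have k1 := key K ρ sT sT sV
  have k2 := key (-K) ρ sV sT sT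
  rw [e1, covDir_add (FieldSmoothAt.covDir_of_forall g hF sDV σ q) ((k1.1 q).add (k2.1 q)),
    covDir_add (k1.1 q) (k2.1 q), k1.2, k2.2]
  -- commute the `ρ` derivative with both `σ` derivatives
  have e2 : covDir g F (covDir g F (covDir g F (velDir F ρ) σ) σ) ρ q
      = covDir g F (covDir g F (covDir g F (velDir F ρ) σ) ρ) σ q
        + curv g (F q) V T DV := by
    have := covDir_covDir_sub g hF (Eventually.of_forall (f := 𝓝 q) sDV) ρ σ
    rw [hV, hT, hDV] at this
    rw [← this]
    abel
  have e3 : covDir g F (covDir g F (velDir F ρ) σ) ρ = fun q =>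
      covDir g F (covDir g F (velDir F ρ) ρ) σ q
        + ((K * metric g (F q) (velDir F σ q) (velDir F ρ q)) • velDir F ρ q
          + (-K * metric g (F q) (velDir F ρ q) (velDir F ρ q)) • velDir F σ q) := by
    funext q
    have := covDir_covDir_sub g hF (Eventually.of_forall (f := 𝓝 q) sV) ρ σ
    rw [curv_eq_of_hasConstantCurvature g hK, ← neg_mul] at this
    rw [← this]
    abel
  have k3 := key K σ sT sV sV
  have k4 := key (-K) σ sV sV sT
  rw [e2, e3, covDir_add (FieldSmoothAt.covDir_of_forall g hF sA σ q) ((k3.1 q).add (k4.1 q)),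
    covDir_add (k3.1 q) (k4.1 q), k3.2, k4.2, hDV', hDV, hV, hT, hA, hDT,
    curv_eq_of_hasConstantCurvature g hK, curv_eq_of_hasConstantCurvature g hK,
    metric_symm g (F q) DV T, metric_symm g (F q) DV V, metric_symm g (F q) V T]
  module

end Variation

/-! ### Variation of the energy -/

section Energy

variable {n : ℕ} {M : Type*} [TopologicalSpace M]
  [ChartedSpace (EuclideanSpace ℝ (Fin n)) M] [IsManifold (𝓡 n) ∞ M]
  {g : Metric n M} {F : ℝ × ℝ → M}

lemma hasDerivAt_metric_slice (g : Metric n M) (hF : ContMDiff 𝓘(ℝ, ℝ × ℝ) (𝓡 n) ∞ F)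
    {X Y : ℝ × ℝ → EuclideanSpace ℝ (Fin n)} {q : ℝ × ℝ} (hX : FieldSmoothAt F X q)
    (hY : FieldSmoothAt F Y q) :
    HasDerivAt (fun t => metric g (F (t, q.2)) (X (t, q.2)) (Y (t, q.2)))
      (metric g (F q) (covDir g F X (1, 0) q) (Y q)
        + metric g (F q) (X q) (covDir g F Y (1, 0) q)) q.1 := by
  rw [← fderiv_metric g hF hX hY]
  have h := ((contDiffAt_metric g hF hX hY).differentiableAt (by simp)).hasFDerivAt
  exact HasFDerivAt.comp_hasDerivAt (f := fun t => (t, q.2)) q.1 h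
    ((hasDerivAt_id q.1).prodMk (hasDerivAt_const q.1 q.2))

/-- The tension field of the curves `s ↦ F (t, s)`. -/
def tens (g : Metric n M) (F : ℝ × ℝ → M) : ℝ × ℝ → EuclideanSpace ℝ (Fin n) :=
  covDir g F (velDir F (0, 1)) (0, 1)

/-- The squared length of the tension field of the curves `s ↦ F (t, s)`. -/
def tensSq (g : Metric n M) (F : ℝ × ℝ → M) (q : ℝ × ℝ) : ℝ :=
  metric g (F q) (tens g F q) (tens g F q)

/-- The first `t`-derivative of the energy density. -/
def density₁ (g : Metric n M) (p : ℝ) (F : ℝ × ℝ → M) (q : ℝ × ℝ) : ℝ :=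
  tensSq g F q ^ (p / 2 - 1) * metric g (F q) (covDir g F (tens g F) (1, 0) q) (tens g F q)

/-- The second `t`-derivative of the energy density. -/
def density₂ (g : Metric n M) (p : ℝ) (F : ℝ × ℝ → M) (q : ℝ × ℝ) : ℝ :=
  (p - 2) * tensSq g F q ^ (p / 2 - 2)
      * metric g (F q) (covDir g F (tens g F) (1, 0) q) (tens g F q) ^ 2
    + tensSq g F q ^ (p / 2 - 1)
      * (metric g (F q) (covDir g F (covDir g F (tens g F) (1, 0)) (1, 0) q) (tens g F q)
        + metric g (F q) (covDir g F (tens g F) (1, 0) q) (covDir g F (tens g F) (1, 0) q))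

lemma hasDerivAt_pair_right (t s : ℝ) : HasDerivAt (fun u : ℝ => (t, u)) ((0 : ℝ), (1 : ℝ)) s :=
  (hasDerivAt_const s t).prodMk (hasDerivAt_id s)

lemma hasDerivAt_pair_left (t s : ℝ) : HasDerivAt (fun u : ℝ => (u, s)) ((1 : ℝ), (0 : ℝ)) t :=
  (hasDerivAt_id t).prodMk (hasDerivAt_const t s)

lemma tension_comp (g : Metric n M) (hF : ContMDiff 𝓘(ℝ, ℝ × ℝ) (𝓡 n) ∞ F) {ι : ℝ → ℝ × ℝ}
    {w : ℝ × ℝ} (hι : ContDiff ℝ ∞ ι) (hι' : ∀ u, HasDerivAt ι w u) (s : ℝ) :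
    tension g (fun u => F (ι u)) s = covDir g F (velDir F w) w (ι s) := by
  have h : velDir (n := n) (fun u => F (ι u)) (1 : ℝ) = fun u => velDir F w (ι u) :=
    funext fun u => velDir_comp hF (hι' u)
  refine (tension_eq_covDir g (contMDiff_slice hF hι) s).trans ?_
  rw [h]
  exact covDir_comp hF (hι' s) (FieldSmoothAt.velDir hF _ _)

lemma energy_slice (g : Metric n M) (hF : ContMDiff 𝓘(ℝ, ℝ × ℝ) (𝓡 n) ∞ F) (p a b t : ℝ) :
    energy g p a b (fun u => F (t, u))
      = ∫ s in a..b, 1 / p * Real.sqrt (tensSq g F (t, s)) ^ p := by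
  rw [intervalIntegral.integral_const_mul, energy]
  congr 1
  refine intervalIntegral.integral_congr fun s _ => ?_
  have h : tension g (fun u => F (t, u)) s = tens g F (t, s) :=
    tension_comp g hF (by fun_prop) (hasDerivAt_pair_right t) s
  simp only [tensSq, metric]
  rw [← h]

lemma fieldSmoothAt_tens (hF : ContMDiff 𝓘(ℝ, ℝ × ℝ) (𝓡 n) ∞ F) (q : ℝ × ℝ) :
    FieldSmoothAt F (tens g F) q :=
  FieldSmoothAt.covDir_of_forall g hF (FieldSmoothAt.velDir hF _) _ _

lemma continuous_tensSq (g : Metric n M) (hF : ContMDiff 𝓘(ℝ, ℝ × ℝ) (𝓡 n) ∞ F) :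
    Continuous (tensSq g F) :=
  continuous_iff_continuousAt.2 fun q =>
    (contDiffAt_metric g hF (fieldSmoothAt_tens hF q) (fieldSmoothAt_tens hF q)).continuousAt

lemma isOpen_tensSq_pos (g : Metric n M) (hF : ContMDiff 𝓘(ℝ, ℝ × ℝ) (𝓡 n) ∞ F) :
    IsOpen {q | 0 < tensSq g F q} :=
  isOpen_lt continuous_const (continuous_tensSq g hF)

lemma continuousOn_density₁ (g : Metric n M) (hF : ContMDiff 𝓘(ℝ, ℝ × ℝ) (𝓡 n) ∞ F) (p : ℝ) :
    ContinuousOn (density₁ g p F) {q | 0 < tensSq g F q} := by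
  intro q hq
  have sW := fieldSmoothAt_tens (g := g) hF
  have sW1 := FieldSmoothAt.covDir_of_forall g hF sW (1, 0)
  exact (((continuous_tensSq g hF).continuousAt.rpow_const (Or.inl (ne_of_gt hq))).mul
    (contDiffAt_metric g hF (sW1 q) (sW q)).continuousAt).continuousWithinAt

lemma continuousOn_density₂ (g : Metric n M) (hF : ContMDiff 𝓘(ℝ, ℝ × ℝ) (𝓡 n) ∞ F) (p : ℝ) :
    ContinuousOn (density₂ g p F) {q | 0 < tensSq g F q} := by
  intro q hq
  have sW := fieldSmoothAt_tens (g := g) hF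
  have sW1 := FieldSmoothAt.covDir_of_forall g hF sW (1, 0)
  have sW2 := FieldSmoothAt.covDir_of_forall g hF sW1 (1, 0)
  have hc := (continuous_tensSq g hF).continuousAt (x := q)
  exact (((continuousAt_const.mul (hc.rpow_const (Or.inl (ne_of_gt hq)))).mul
    ((contDiffAt_metric g hF (sW1 q) (sW q)).continuousAt.pow 2)).add
    ((hc.rpow_const (Or.inl (ne_of_gt hq))).mul
      ((contDiffAt_metric g hF (sW2 q) (sW q)).continuousAt.add
        (contDiffAt_metric g hF (sW1 q) (sW1 q)).continuousAt))).continuousWithinAt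

/-- The first variation of the energy, at a curve whose curvature does not vanish. -/
lemma hasDerivAt_energy (g : Metric n M) (hF : ContMDiff 𝓘(ℝ, ℝ × ℝ) (𝓡 n) ∞ F) {p a b t₀ : ℝ}
    (hp : 0 < p) (hab : a ≤ b) (h : ∀ s ∈ Icc a b, 0 < tensSq g F (t₀, s)) :
    HasDerivAt (fun t => energy g p a b (fun u => F (t, u)))
      (∫ s in a..b, density₁ g p F (t₀, s)) t₀ := by
  simp only [energy_slice g hF]
  refine hasDerivAt_integral_of_continuousOn (isOpen_tensSq_pos g hF)
    (f := fun q => 1 / p * Real.sqrt (tensSq g F q) ^ p) ?_ (continuousOn_density₁ g hF p) ?_ hab h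
  · exact (continuous_const.mul ((Real.continuous_sqrt.comp (continuous_tensSq g hF)).rpow_const
      fun _ => Or.inr hp.le)).continuousOn
  · intro q hq
    have sW := fieldSmoothAt_tens (g := g) hF
    have h1 := hasDerivAt_metric_slice g hF (sW q) (sW q)
    change HasDerivAt (fun t => tensSq g F (t, q.2)) _ q.1 at h1
    have h2 := (h1.rpow_const (p := p / 2) (Or.inl (ne_of_gt hq))).const_mul (1 / p)
    refine (h2.congr_of_eventuallyEq ?_).congr_deriv ?_
    · have hpos : ∀ᶠ t in 𝓝 q.1, 0 < tensSq g F (t, q.2) :=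
        h1.continuousAt.eventually (lt_mem_nhds (show 0 < tensSq g F (q.1, q.2) from hq))
      filter_upwards [hpos] with t ht
      rw [Real.sqrt_eq_rpow, ← Real.rpow_mul ht.le]
      ring_nf
    · rw [metric_symm g (F q) (tens g F q), density₁]
      have : tensSq g F (q.1, q.2) = tensSq g F q := rfl
      rw [this]
      field_simp
      ring

/-- The second variation of the energy, at a curve whose curvature does not vanish. -/
lemma hasDerivAt_integral_density₁ (g : Metric n M) (hF : ContMDiff 𝓘(ℝ, ℝ × ℝ) (𝓡 n) ∞ F)
    (p : ℝ) {a b t₀ : ℝ} (hab : a ≤ b) (h : ∀ s ∈ Icc a b, 0 < tensSq g F (t₀, s)) :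
    HasDerivAt (fun t => ∫ s in a..b, density₁ g p F (t, s))
      (∫ s in a..b, density₂ g p F (t₀, s)) t₀ := by
  refine hasDerivAt_integral_of_continuousOn (isOpen_tensSq_pos g hF)
    (continuousOn_density₁ g hF p) (continuousOn_density₂ g hF p) ?_ hab h
  intro q hq
  have sW := fieldSmoothAt_tens (g := g) hF
  have sW1 := FieldSmoothAt.covDir_of_forall g hF sW (1, 0)
  have h1 := hasDerivAt_metric_slice g hF (sW q) (sW q)
  change HasDerivAt (fun t => tensSq g F (t, q.2)) _ q.1 at h1
  have h2 := (h1.rpow_const (p := p / 2 - 1) (Or.inl (ne_of_gt hq))).mul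
    (hasDerivAt_metric_slice g hF (sW1 q) (sW q))
  refine h2.congr_deriv ?_
  have : tensSq g F (q.1, q.2) = tensSq g F q := rfl
  rw [metric_symm g (F q) (tens g F q), density₂, this]
  simp only [Prod.mk.eta]
  rw [show p / 2 - 1 - 1 = p / 2 - 2 by ring]
  ring

end Energy

/-! ### Integration by parts and the Euler–Lagrange equation -/

section EulerLagrange

variable {n : ℕ} {M : Type*} [TopologicalSpace M]
  [ChartedSpace (EuclideanSpace ℝ (Fin n)) M] [IsManifold (𝓡 n) ∞ M]
  {g : Metric n M} {c : ℝ → M}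

/-- The tension field `∇_{c'} c'` of a curve, as a function on the model space. -/
def curveTens (g : Metric n M) (c : ℝ → M) : ℝ → EuclideanSpace ℝ (Fin n) :=
  covDir g c (velDir c (1 : ℝ)) (1 : ℝ)

/-- The squared length of the tension field of a curve. -/
def curveTensSq (g : Metric n M) (c : ℝ → M) (s : ℝ) : ℝ :=
  metric g (c s) (curveTens g c s) (curveTens g c s)

/-- The momentum `|∇_{c'} c'| ^ (p - 2) ∇_{c'} c'`. -/
def momentum (g : Metric n M) (p : ℝ) (c : ℝ → M) (s : ℝ) : EuclideanSpace ℝ (Fin n) :=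
  curveTensSq g c s ^ (p / 2 - 1) • curveTens g c s

/-- The Jacobi operator `∇_T ∇_T A + R(A, T)T` along a curve with velocity `T`. -/
def jacobi (g : Metric n M) (c : ℝ → M) (A : ℝ → EuclideanSpace ℝ (Fin n)) (s : ℝ) :
    EuclideanSpace ℝ (Fin n) :=
  covDir g c (covDir g c A (1 : ℝ)) (1 : ℝ) s
    + curv g (c s) (A s) (velDir c (1 : ℝ) s) (velDir c (1 : ℝ) s)

lemma fieldSmoothAt_curveTens (hc : ContMDiff 𝓘(ℝ, ℝ) (𝓡 n) ∞ c) (s : ℝ) :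
    FieldSmoothAt c (curveTens g c) s :=
  FieldSmoothAt.covDir_of_forall g hc (FieldSmoothAt.velDir hc _) _ _

lemma contDiff_curveTensSq (g : Metric n M) (hc : ContMDiff 𝓘(ℝ, ℝ) (𝓡 n) ∞ c) :
    ContDiff ℝ ∞ (curveTensSq g c) :=
  contDiff_iff_contDiffAt.2 fun s =>
    contDiffAt_metric g hc (fieldSmoothAt_curveTens hc s) (fieldSmoothAt_curveTens hc s)

lemma fieldSmoothAt_momentum (hc : ContMDiff 𝓘(ℝ, ℝ) (𝓡 n) ∞ c) (p : ℝ) {s : ℝ}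
    (h : 0 < curveTensSq g c s) : FieldSmoothAt c (momentum g p c) s :=
  (fieldSmoothAt_curveTens hc s).smul
    ((contDiff_curveTensSq g hc).contDiffAt.rpow_const_of_ne h.ne')

lemma eventually_curveTensSq_pos (hc : ContMDiff 𝓘(ℝ, ℝ) (𝓡 n) ∞ c) {s : ℝ}
    (h : 0 < curveTensSq g c s) : ∀ᶠ u in 𝓝 s, 0 < curveTensSq g c u :=
  (contDiff_curveTensSq g hc).continuous.continuousAt.eventually (lt_mem_nhds h)

lemma FieldSmoothAt.curv {K : ℝ} (hK : HasConstantCurvature g K)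
    (hc : ContMDiff 𝓘(ℝ, ℝ) (𝓡 n) ∞ c) {A : ℝ → EuclideanSpace ℝ (Fin n)} {s : ℝ}
    (hA : FieldSmoothAt c A s) :
    FieldSmoothAt c (fun s => PBiharmonic.curv g (c s) (A s) (PBiharmonic.velDir c (1 : ℝ) s)
      (PBiharmonic.velDir c (1 : ℝ) s)) s := by
  have hT := FieldSmoothAt.velDir (n := n) hc (1 : ℝ) s
  simp only [curv_eq_of_hasConstantCurvature g hK]
  exact (hA.smul (contDiffAt_const.mul (contDiffAt_metric g hc hT hT))).add
    (hT.smul (contDiffAt_const.mul (contDiffAt_metric g hc hA hT)).neg)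

lemma fieldSmoothAt_jacobi {K : ℝ} (hK : HasConstantCurvature g K)
    (hc : ContMDiff 𝓘(ℝ, ℝ) (𝓡 n) ∞ c) {A : ℝ → EuclideanSpace ℝ (Fin n)} {s : ℝ}
    (hA : ∀ᶠ u in 𝓝 s, FieldSmoothAt c A u) : FieldSmoothAt c (jacobi g c A) s := by
  refine (FieldSmoothAt.covDir g hc ?_ 1).add (FieldSmoothAt.curv hK hc hA.self_of_nhds)
  exact hA.eventually_nhds.mono fun u hu => FieldSmoothAt.covDir g hc hu 1

lemma hasDerivAt_metric (hc : ContMDiff 𝓘(ℝ, ℝ) (𝓡 n) ∞ c)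
    {X Y : ℝ → EuclideanSpace ℝ (Fin n)} {s : ℝ} (hX : FieldSmoothAt c X s)
    (hY : FieldSmoothAt c Y s) :
    HasDerivAt (fun s => metric g (c s) (X s) (Y s))
      (metric g (c s) (covDir g c X (1 : ℝ) s) (Y s)
        + metric g (c s) (X s) (covDir g c Y (1 : ℝ) s)) s := by
  rw [← fderiv_metric g hc hX hY]
  exact ((contDiffAt_metric g hc hX hY).differentiableAt (by simp)).hasFDerivAt.hasDerivAt

/-- The boundary term which the Jacobi operator leaves when it is integrated by parts. -/
def boundaryTerm (g : Metric n M) (p : ℝ) (c : ℝ → M) (A : ℝ → EuclideanSpace ℝ (Fin n))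
    (s : ℝ) : ℝ :=
  metric g (c s) (covDir g c A (1 : ℝ) s) (momentum g p c s)
    - metric g (c s) (A s) (covDir g c (momentum g p c) (1 : ℝ) s)

lemma metric_sub_right (g : Metric n M) (x : M) (u v w : EuclideanSpace ℝ (Fin n)) :
    metric g x w (u - v) = metric g x w u - metric g x w v :=
  map_sub (metricForm g x w) u v

lemma metric_sub_left (g : Metric n M) (x : M) (u v w : EuclideanSpace ℝ (Fin n)) :
    metric g x (u - v) w = metric g x u w - metric g x v w := by
  rw [metric_symm, metric_sub_right, metric_symm, metric_symm g x w]

/-- The Jacobi operator is formally self-adjoint. -/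
lemma integral_jacobi {K : ℝ} (hK : HasConstantCurvature g K) (hc : ContMDiff 𝓘(ℝ, ℝ) (𝓡 n) ∞ c)
    (p : ℝ) {a b : ℝ} (hab : a ≤ b) (hpos : ∀ s ∈ Icc a b, 0 < curveTensSq g c s)
    {A : ℝ → EuclideanSpace ℝ (Fin n)} (hA : ∀ s, FieldSmoothAt c A s) :
    ∫ s in a..b, metric g (c s) (jacobi g c A s) (momentum g p c s)
      = boundaryTerm g p c A b - boundaryTerm g p c A a
        + ∫ s in a..b, metric g (c s) (A s) (jacobi g c (momentum g p c) s) := by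
  have sY : ∀ s ∈ Icc a b, ∀ᶠ u in 𝓝 s, FieldSmoothAt c (momentum g p c) u := fun s hs =>
    (eventually_curveTensSq_pos hc (hpos s hs)).mono fun u hu => fieldSmoothAt_momentum hc p hu
  have sDY : ∀ s ∈ Icc a b, FieldSmoothAt c (covDir g c (momentum g p c) (1 : ℝ)) s :=
    fun s hs => FieldSmoothAt.covDir g hc (sY s hs) 1
  have sDA := FieldSmoothAt.covDir_of_forall g hc hA (1 : ℝ)
  have i1 : ContinuousOn
      (fun s => metric g (c s) (jacobi g c A s) (momentum g p c s)) (uIcc a b) := by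
    rw [uIcc_of_le hab]
    exact fun s hs => (contDiffAt_metric g hc (fieldSmoothAt_jacobi hK hc
      (Eventually.of_forall hA)) (sY s hs).self_of_nhds).continuousAt.continuousWithinAt
  have i2 : ContinuousOn
      (fun s => metric g (c s) (A s) (jacobi g c (momentum g p c) s)) (uIcc a b) := by
    rw [uIcc_of_le hab]
    exact fun s hs => (contDiffAt_metric g hc (hA s)
      (fieldSmoothAt_jacobi hK hc (sY s hs))).continuousAt.continuousWithinAt
  rw [← sub_eq_iff_eq_add, ← intervalIntegral.integral_sub i1.intervalIntegrable
    i2.intervalIntegrable]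
  refine intervalIntegral.integral_eq_sub_of_hasDerivAt (fun s hs => ?_)
    (i1.sub i2).intervalIntegrable
  rw [uIcc_of_le hab] at hs
  have h := (hasDerivAt_metric (g := g) hc (sDA s) (sY s hs).self_of_nhds).sub
    (hasDerivAt_metric (g := g) hc (hA s) (sDY s hs))
  refine h.congr_deriv ?_
  simp only [jacobi, metric_add_left, metric_add_right, curv_eq_of_hasConstantCurvature g hK,
    metric_smul_left, metric_smul_right]
  rw [metric_symm g (c s) (A s) (velDir c (1 : ℝ) s),
    metric_symm g (c s) (momentum g p c s) (velDir c (1 : ℝ) s)]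
  ring

variable {F : ℝ × ℝ → M}

lemma covDir_slice (hF : ContMDiff 𝓘(ℝ, ℝ × ℝ) (𝓡 n) ∞ F) (hFc : ∀ u, F (0, u) = c u)
    {X : ℝ × ℝ → EuclideanSpace ℝ (Fin n)} (hX : ∀ q, FieldSmoothAt F X q) (s : ℝ) :
    covDir g F X (0, 1) (0, s) = covDir g c (fun u => X (0, u)) (1 : ℝ) s := by
  obtain rfl : c = fun u => F (0, u) := funext fun u => (hFc u).symm
  exact (covDir_comp hF (hasDerivAt_pair_right 0 s) (hX _)).symm

lemma velDir_slice (hF : ContMDiff 𝓘(ℝ, ℝ × ℝ) (𝓡 n) ∞ F) (hFc : ∀ u, F (0, u) = c u) (s : ℝ) :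
    velDir F (0, 1) (0, s) = velDir (n := n) c (1 : ℝ) s := by
  obtain rfl : c = fun u => F (0, u) := funext fun u => (hFc u).symm
  exact (velDir_comp hF (hasDerivAt_pair_right 0 s)).symm

lemma covDir_covDir_slice (hF : ContMDiff 𝓘(ℝ, ℝ × ℝ) (𝓡 n) ∞ F) (hFc : ∀ u, F (0, u) = c u)
    {X : ℝ × ℝ → EuclideanSpace ℝ (Fin n)} (hX : ∀ q, FieldSmoothAt F X q) (s : ℝ) :
    covDir g F (covDir g F X (0, 1)) (0, 1) (0, s)
      = covDir g c (covDir g c (fun u => X (0, u)) (1 : ℝ)) (1 : ℝ) s := by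
  rw [covDir_slice hF hFc (FieldSmoothAt.covDir_of_forall g hF hX _)]
  congr 1
  exact funext fun u => covDir_slice hF hFc hX u

lemma tens_slice (hF : ContMDiff 𝓘(ℝ, ℝ × ℝ) (𝓡 n) ∞ F) (hFc : ∀ u, F (0, u) = c u) (s : ℝ) :
    tens g F (0, s) = curveTens g c s := by
  rw [tens, covDir_slice hF hFc (FieldSmoothAt.velDir hF _), curveTens]
  congr 1
  exact funext fun u => velDir_slice hF hFc u

lemma tensSq_slice (hF : ContMDiff 𝓘(ℝ, ℝ × ℝ) (𝓡 n) ∞ F) (hFc : ∀ u, F (0, u) = c u) (s : ℝ) :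
    tensSq g F (0, s) = curveTensSq g c s := by
  rw [tensSq, tens_slice hF hFc, hFc, curveTensSq]

lemma covDir_tens_slice (hF : ContMDiff 𝓘(ℝ, ℝ × ℝ) (𝓡 n) ∞ F) (hFc : ∀ u, F (0, u) = c u)
    (s : ℝ) : covDir g F (tens g F) (1, 0) (0, s)
      = jacobi g c (fun u => velDir F (1, 0) (0, u)) s := by
  rw [tens, covDir_tension g hF, covDir_covDir_slice hF hFc (FieldSmoothAt.velDir hF _),
    velDir_slice hF hFc, hFc, jacobi]

lemma density₁_slice (hF : ContMDiff 𝓘(ℝ, ℝ × ℝ) (𝓡 n) ∞ F) (hFc : ∀ u, F (0, u) = c u)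
    (p s : ℝ) :
    density₁ g p F (0, s)
      = metric g (c s) (jacobi g c (fun u => velDir F (1, 0) (0, u)) s) (momentum g p c s) := by
  rw [density₁, covDir_tens_slice hF hFc, tensSq_slice hF hFc, tens_slice hF hFc, hFc, momentum,
    metric_smul_right]

lemma covDir_zero_field (s : ℝ) : covDir g c (fun _ => 0) (1 : ℝ) s = 0 := by
  simp [covDir]

/-- A variation of `c` near `c s₀` by a compactly supported bump in the chart at `c s₀`. -/
lemma exists_bump_variation (hc : ContMDiff 𝓘(ℝ, ℝ) (𝓡 n) ∞ c) {s₀ : ℝ} {O : Set ℝ}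
    (hO : O ∈ 𝓝 s₀) (z : EuclideanSpace ℝ (Fin n)) :
    ∃ (F : ℝ × ℝ → M) (δ : ℝ) (χ : ℝ → ℝ), ContMDiff 𝓘(ℝ, ℝ × ℝ) (𝓡 n) ∞ F ∧
      (∀ u, F (0, u) = c u) ∧ 0 < δ ∧ Metric.ball s₀ δ ⊆ O ∧
      (∀ s, 0 ≤ χ s) ∧ 0 < χ s₀ ∧
      (∀ t s, s ∉ Metric.ball s₀ (δ / 2) → F (t, s) = c s) ∧
      (∀ s, s ∉ Metric.ball s₀ (δ / 2) → χ s = 0) ∧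
      ∀ s, velDir F (1, 0) (0, s) = χ s • fromChart (c s₀) (c s) z := by
  set x₀ := c s₀ with hx₀
  set φ := extChartAt (𝓡 n) x₀ with hφ
  have hsrc : x₀ ∈ φ.source := mem_extChartAt_source x₀
  obtain ⟨r, hr, hball⟩ := Metric.nhds_basis_ball.mem_iff.1
    ((isOpen_extChartAt_target (I := 𝓡 n) x₀).mem_nhds (mem_extChartAt_target x₀))
  have hcont : ContinuousAt (fun s => φ (c s)) s₀ :=
    (contDiffAt_extChartAt_comp hc hsrc).continuousAt
  have hev : ∀ᶠ s in 𝓝 s₀, s ∈ O ∧ c s ∈ φ.source ∧ φ (c s) ∈ Metric.ball (φ x₀) (r / 2) :=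
    Filter.Eventually.and hO ((eventually_mem_source hc hsrc).and
      (hcont.eventually (Metric.ball_mem_nhds _ (half_pos hr))))
  obtain ⟨δ, hδ, hδs⟩ := Metric.nhds_basis_ball.mem_iff.1 hev
  let β : ContDiffBump s₀ := ⟨δ / 4, δ / 2, by positivity, by linarith⟩
  -- `sin t` is bounded with derivative `1` at `0`, so with this factor `ε` the displacement stays
  -- inside the chart for all `t`, not only for small ones
  set ε := r / (2 * (‖z‖ + 1)) with hε
  have hεpos : 0 < ε := by positivity
  have hεz : ε * ‖z‖ < r / 2 := by
    rw [hε, div_mul_eq_mul_div, div_lt_div_iff₀ (by positivity) (by norm_num)]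
    nlinarith [norm_nonneg z]
  have hβ0 : ∀ s, s ∉ Metric.ball s₀ (δ / 2) → β s = 0 := fun s hs =>
    β.zero_of_le_dist (by simpa using hs)
  set G : ℝ × ℝ → M := fun q => φ.symm (φ (c q.2) + (Real.sin q.1 * (β q.2 * ε)) • z) with hG
  have htar : ∀ t s, s ∈ Metric.ball s₀ δ →
      φ (c s) + (Real.sin t * (β s * ε)) • z ∈ φ.target := by
    intro t s hs
    refine hball ?_
    have h1 := (hδs hs).2.2
    rw [Metric.mem_ball, dist_eq_norm] at h1 ⊢
    have h2 : ‖(Real.sin t * (β s * ε)) • z‖ ≤ ε * ‖z‖ := by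
      rw [norm_smul, Real.norm_eq_abs, abs_mul, abs_mul, abs_of_nonneg β.nonneg,
        abs_of_pos hεpos]
      refine mul_le_mul_of_nonneg_right ?_ (norm_nonneg z)
      have := Real.abs_sin_le_one t
      have h3 : β s * ε ≤ 1 * ε := mul_le_mul_of_nonneg_right β.le_one hεpos.le
      have h4 : 0 ≤ β s * ε := mul_nonneg β.nonneg hεpos.le
      nlinarith
    calc ‖φ (c s) + (Real.sin t * (β s * ε)) • z - φ x₀‖
        = ‖(φ (c s) - φ x₀) + (Real.sin t * (β s * ε)) • z‖ := by congr 1; abel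
      _ ≤ _ := norm_add_le _ _
      _ < r := by linarith
  have hGc : ∀ t s, s ∈ Metric.ball s₀ δ → s ∉ Metric.ball s₀ (δ / 2) → G (t, s) = c s := by
    intro t s hs hs'
    simp only [hG, hβ0 s hs', zero_mul, mul_zero, zero_smul, add_zero]
    exact φ.left_inv (hδs hs).2.1
  classical
  set F : ℝ × ℝ → M := fun q => if q.2 ∈ Metric.ball s₀ δ then G q else c q.2 with hFdef
  have hFout : ∀ t s, s ∉ Metric.ball s₀ (δ / 2) → F (t, s) = c s := by
    intro t s hs
    simp only [hFdef]
    split_ifs with h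
    · exact hGc t s h hs
    · rfl
  have hF : ContMDiff 𝓘(ℝ, ℝ × ℝ) (𝓡 n) ∞ F := by
    rintro ⟨t, s⟩
    by_cases hs : s ∈ Metric.ball s₀ δ
    · have hopen : ∀ᶠ q : ℝ × ℝ in 𝓝 (t, s), q.2 ∈ Metric.ball s₀ δ :=
        continuous_snd.continuousAt.eventually (Metric.isOpen_ball.mem_nhds hs)
      have hG' : ContMDiffAt 𝓘(ℝ, ℝ × ℝ) (𝓡 n) ∞ G (t, s) := by
        refine ContMDiffAt.comp (t, s) (contMDiffAt_extChartAt_symm_of_mem (htar t s hs)) ?_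
        rw [contMDiffAt_iff_contDiffAt]
        have h1 : ContDiffAt ℝ ∞ (fun q : ℝ × ℝ => φ (c q.2)) (t, s) :=
          ContDiffAt.comp (g := fun s => φ (c s)) (t, s)
            (contDiffAt_extChartAt_comp hc (hδs hs).2.1) contDiffAt_snd
        have h2 : ContDiffAt ℝ ∞ (fun q : ℝ × ℝ => β q.2) (t, s) :=
          ContDiffAt.comp (g := β) (t, s) β.contDiffAt contDiffAt_snd
        exact h1.add ((((Real.contDiff_sin.comp contDiff_fst).contDiffAt).mul
          (h2.mul contDiffAt_const)).smul contDiffAt_const)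
      refine hG'.congr_of_eventuallyEq ?_
      filter_upwards [hopen] with q hq
      simp only [hFdef, if_pos hq]
    · have hopen : ∀ᶠ q : ℝ × ℝ in 𝓝 (t, s), q.2 ∈ (Metric.closedBall s₀ (δ / 2))ᶜ := by
        refine continuous_snd.continuousAt.eventually
          (Metric.isClosed_closedBall.isOpen_compl.mem_nhds ?_)
        simp only [Metric.mem_ball, not_lt, mem_compl_iff, Metric.mem_closedBall, not_le] at hs ⊢
        linarith
      have h1 : ContMDiffAt 𝓘(ℝ, ℝ × ℝ) (𝓡 n) ∞ (fun q : ℝ × ℝ => c q.2) (t, s) :=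
        ContMDiffAt.comp (t, s) hc.contMDiffAt contDiffAt_snd.contMDiffAt
      refine h1.congr_of_eventuallyEq ?_
      filter_upwards [hopen] with q hq
      exact hFout q.1 q.2 fun h => hq (Metric.ball_subset_closedBall h)
  refine ⟨F, δ, fun s => β s * ε, hF, fun u => ?_, hδ, fun s hs => (hδs hs).1,
    fun s => mul_nonneg β.nonneg hεpos.le, ?_, hFout, fun s hs => by simp [hβ0 s hs], fun s => ?_⟩
  · simp only [hFdef]
    split_ifs with h
    · simp only [hG, Real.sin_zero, zero_mul, zero_smul, add_zero]
      exact φ.left_inv (hδs h).2.1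
    · rfl
  · have : β s₀ = 1 := β.one_of_mem_closedBall (Metric.mem_closedBall_self β.rIn_pos.le)
    simpa [this] using hεpos
  · rw [← velDir_comp hF (hasDerivAt_pair_left 0 s)]
    by_cases hs : s ∈ Metric.ball s₀ (δ / 2)
    · have hs' : s ∈ Metric.ball s₀ δ := Metric.ball_subset_ball (by linarith) hs
      have hFs : ∀ t, F (t, s) = φ.symm (φ (c s) + (Real.sin t * (β s * ε)) • z) := fun t => by
        simp only [hFdef, if_pos hs', hG]
      have hF0 : F (0, s) = c s := by
        rw [hFs, Real.sin_zero, zero_mul, zero_smul, add_zero, φ.left_inv (hδs hs').2.1]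
      have hmem : F (0, s) ∈ φ.source := by rw [hF0]; exact (hδs hs').2.1
      have h1 := toChart_velDir (contMDiff_slice hF (ι := fun t => (t, s)) (by fun_prop))
        (q := (0 : ℝ)) hmem (1 : ℝ)
      have h2 : HasDerivAt (fun t => φ (F (t, s))) ((β s * ε) • z) 0 := by
        have h3 : HasDerivAt (fun t => φ (c s) + (Real.sin t * (β s * ε)) • z)
            ((Real.cos 0 * (β s * ε)) • z) 0 :=
          (((Real.hasDerivAt_sin 0).mul_const _).smul_const z).const_add _
        rw [Real.cos_zero, one_mul] at h3
        refine h3.congr_of_eventuallyEq (Eventually.of_forall fun t => ?_)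
        simp only [hFs]
        exact φ.right_inv (htar t s hs')
      have h4 : fderiv ℝ (fun t => φ (F (t, s))) 0 (1 : ℝ) = (β s * ε) • z := h2.deriv
      rw [← map_smul, ← h4, ← h1, ← hF0, fromChart_toChart hmem]
    · have hFs : (fun t => F (t, s)) = fun _ => c s := funext fun t => hFout t s hs
      rw [hFs]
      simp [velDir, hβ0 s hs]

/-- The Euler–Lagrange equation of the `p`-bienergy. -/
lemma jacobi_momentum_eq_zero {K : ℝ} (hK : HasConstantCurvature g K) {p a b : ℝ} (hp : 0 < p)
    (hab : a < b) (hc : IsPBiharmonic g p a b c) (hpos : ∀ s ∈ Icc a b, 0 < curveTensSq g c s)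
    {s₀ : ℝ} (hs₀ : s₀ ∈ Ioo a b) : jacobi g c (momentum g p c) s₀ = 0 := by
  -- otherwise vary along a bump in the direction of the value `z` at `s₀`
  by_contra hne
  obtain ⟨hc, hcrit⟩ := hc
  set z := jacobi g c (momentum g p c) s₀ with hz
  have sY : ∀ s ∈ Icc a b, ∀ᶠ u in 𝓝 s, FieldSmoothAt c (momentum g p c) u := fun s hs =>
    (eventually_curveTensSq_pos hc (hpos s hs)).mono fun u hu => fieldSmoothAt_momentum hc p hu
  have sZ : ∀ s ∈ Icc a b, FieldSmoothAt c (jacobi g c (momentum g p c)) s := fun s hs =>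
    fieldSmoothAt_jacobi hK hc (sY s hs)
  have sz : FieldSmoothAt c (fun s => fromChart (c s₀) (c s) z) s₀ := by
    have h : ContDiffAt ℝ ∞ (fun _ : ℝ => z) s₀ := contDiffAt_const
    refine h.congr_of_eventuallyEq ?_
    filter_upwards [eventually_mem_source hc (mem_extChartAt_source (c s₀))] with s hs
    exact toChart_fromChart hs z
  set f : ℝ → ℝ := fun s =>
    metric g (c s) (fromChart (c s₀) (c s) z) (jacobi g c (momentum g p c) s) with hf
  have hf0 : 0 < f s₀ := by
    have : fromChart (c s₀) (c s₀) z = z := toChart_self _ _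
    simp only [hf, this]
    exact metric_pos g _ hne
  have hO : {s | s ∈ Ioo a b ∧ 0 < f s} ∈ 𝓝 s₀ :=
    Filter.Eventually.and (isOpen_Ioo.mem_nhds hs₀)
      ((contDiffAt_metric g hc sz (sZ s₀ (Ioo_subset_Icc_self hs₀))).continuousAt.eventually
        (lt_mem_nhds hf0))
  obtain ⟨F, δ, χ, hF, hFc, hδ, hsub, hχ, hχ0, hFout, hχout, hV⟩ := exists_bump_variation hc hO z
  have hab' : a ∉ Metric.ball s₀ δ ∧ b ∉ Metric.ball s₀ δ :=
    ⟨fun h => lt_irrefl _ (hsub h).1.1, fun h => lt_irrefl _ (hsub h).1.2⟩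
  have hIcc : Metric.ball s₀ (δ / 2) ⊆ Icc (s₀ - δ / 2) (s₀ + δ / 2) := by
    rw [Real.ball_eq_Ioo]
    exact Ioo_subset_Icc_self
  have hmem : s₀ - δ / 2 ∈ Metric.ball s₀ δ ∧ s₀ + δ / 2 ∈ Metric.ball s₀ δ := by
    rw [Real.ball_eq_Ioo]
    exact ⟨⟨by linarith, by linarith⟩, ⟨by linarith, by linarith⟩⟩
  have hδab : a < s₀ - δ / 2 ∧ s₀ + δ / 2 < b := ⟨(hsub hmem.1).1.1, (hsub hmem.2).1.2⟩
  have hder := hcrit (fun t s => F (t, s)) ⟨hF, hFc⟩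
    ⟨s₀ - δ / 2, s₀ + δ / 2, hδab.1, hδab.2, fun t s hs => hFout t s fun h => hs (hIcc h)⟩
  have hder' := hasDerivAt_energy g hF hp hab.le (t₀ := 0) fun s hs => by
    rw [tensSq_slice hF hFc]; exact hpos s hs
  have hzero := hder'.unique hder
  simp only [density₁_slice hF hFc] at hzero
  set A : ℝ → EuclideanSpace ℝ (Fin n) := fun u => velDir F (1, 0) (0, u) with hA
  have sA : ∀ s, FieldSmoothAt c A s := by
    intro s
    have h := FieldSmoothAt.comp (ι := fun u => ((0 : ℝ), u)) (by fun_prop) (s := s)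
      (FieldSmoothAt.velDir (n := n) hF (1, 0) (0, s))
    obtain rfl : c = fun u => F (0, u) := funext fun u => (hFc u).symm
    exact h
  have hbd : ∀ s, s ∉ Metric.ball s₀ δ → boundaryTerm g p c A s = 0 := by
    intro s hs
    have h0 : A =ᶠ[𝓝 s] fun _ => 0 := by
      have : ∀ᶠ u in 𝓝 s, u ∈ (Metric.closedBall s₀ (δ / 2))ᶜ := by
        refine Metric.isClosed_closedBall.isOpen_compl.mem_nhds ?_
        simp only [Metric.mem_ball, not_lt, mem_compl_iff, Metric.mem_closedBall, not_le] at hs ⊢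
        linarith
      filter_upwards [this] with u hu
      rw [hA]
      simp only [hV]
      rw [hχout u fun h => hu (Metric.ball_subset_closedBall h), zero_smul]
    have hm : ∀ w, metric g (c s) 0 w = 0 := fun w => by
      simpa using metric_smul_left g (c s) 0 0 w
    rw [boundaryTerm, covDir_congr h0, covDir_zero_field, h0.self_of_nhds, hm, hm, sub_zero]
  rw [integral_jacobi hK hc p hab.le hpos sA, hbd a hab'.1, hbd b hab'.2, sub_zero,
    zero_add] at hzero
  have hval : ∀ s, metric g (c s) (A s) (jacobi g c (momentum g p c) s) = χ s * f s := by
    intro s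
    simp only [hA, hV, metric_smul_left, hf]
  refine (intervalIntegral.integral_pos hab (fun s hs => ?_) (fun s hs => ?_)
    ⟨s₀, Ioo_subset_Icc_self hs₀, ?_⟩).ne' hzero
  · exact (contDiffAt_metric g hc (sA s) (sZ s hs)).continuousAt.continuousWithinAt
  · rw [hval]
    by_cases h : s ∈ Metric.ball s₀ (δ / 2)
    · exact mul_nonneg (hχ s) (hsub (Metric.ball_subset_ball (by linarith) h)).2.le
    · rw [hχout s h, zero_mul]
  · rw [hval]
    exact mul_pos hχ0 hf0

end EulerLagrange

/-! ### The Frenet frame -/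

section Frenet

variable {n : ℕ} {M : Type*} [TopologicalSpace M]
  [ChartedSpace (EuclideanSpace ℝ (Fin n)) M] [IsManifold (𝓡 n) ∞ M]
  {g : Metric n M} {a b : ℝ} {c : ℝ → M} {N B : ℝ → EuclideanSpace ℝ (Fin n)} {k τ : ℝ → ℝ}

/-- The Frenet equations, for frame fields with values in the model space. -/
structure FrenetSystem (g : Metric n M) (a b : ℝ) (c : ℝ → M) (N B : ℝ → EuclideanSpace ℝ (Fin n))
    (k τ : ℝ → ℝ) : Prop where
  smooth : ContMDiff 𝓘(ℝ, ℝ) (𝓡 n) ∞ c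
  smooth_N : ∀ s, FieldSmoothAt c N s
  smooth_B : ∀ s, FieldSmoothAt c B s
  smooth_k : ContDiff ℝ ∞ k
  smooth_τ : ContDiff ℝ ∞ τ
  inner_TT : ∀ s ∈ Icc a b, metric g (c s) (velDir c (1 : ℝ) s) (velDir c (1 : ℝ) s) = 1
  inner_NN : ∀ s ∈ Icc a b, metric g (c s) (N s) (N s) = 1
  inner_BB : ∀ s ∈ Icc a b, metric g (c s) (B s) (B s) = 1
  inner_TN : ∀ s ∈ Icc a b, metric g (c s) (velDir c (1 : ℝ) s) (N s) = 0
  inner_TB : ∀ s ∈ Icc a b, metric g (c s) (velDir c (1 : ℝ) s) (B s) = 0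
  inner_NB : ∀ s ∈ Icc a b, metric g (c s) (N s) (B s) = 0
  k_pos : ∀ s ∈ Icc a b, 0 < k s
  deriv_T : ∀ s ∈ Icc a b, curveTens g c s = k s • N s
  deriv_N : ∀ s ∈ Icc a b,
    covDir g c N (1 : ℝ) s = (-k s) • velDir c (1 : ℝ) s + τ s • B s
  deriv_B : ∀ s ∈ Icc a b, covDir g c B (1 : ℝ) s = (-τ s) • N s

lemma jacobi_congr {X Y : ℝ → EuclideanSpace ℝ (Fin n)} {s : ℝ} (h : X =ᶠ[𝓝 s] Y) :
    jacobi g c X s = jacobi g c Y s := by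
  have h1 : covDir g c X (1 : ℝ) =ᶠ[𝓝 s] covDir g c Y (1 : ℝ) :=
    h.eventually_nhds.mono fun u hu => covDir_congr hu 1
  rw [jacobi, jacobi, covDir_congr h1, h.self_of_nhds]

namespace FrenetSystem

/-- The Frenet equations for a combination of the frame fields. -/
lemma covDir_combination (hS : FrenetSystem g a b c N B k τ) {s : ℝ} (hs : s ∈ Icc a b)
    {x y z : ℝ → ℝ} (hx : ContDiffAt ℝ ∞ x s) (hy : ContDiffAt ℝ ∞ y s)
    (hz : ContDiffAt ℝ ∞ z s) :
    covDir g c (fun u => x u • velDir c (1 : ℝ) u + (y u • N u + z u • B u)) (1 : ℝ) s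
      = (deriv x s - k s * y s) • velDir c (1 : ℝ) s
        + ((deriv y s + k s * x s - τ s * z s) • N s + (deriv z s + τ s * y s) • B s) := by
  have sT := FieldSmoothAt.velDir (n := n) hS.smooth (1 : ℝ) s
  have hT : covDir g c (velDir c (1 : ℝ)) (1 : ℝ) s = k s • N s := hS.deriv_T s hs
  rw [covDir_add (sT.smul hx) (((hS.smooth_N s).smul hy).add ((hS.smooth_B s).smul hz)),
    covDir_add ((hS.smooth_N s).smul hy) ((hS.smooth_B s).smul hz), covDir_smul hx sT,
    covDir_smul hy (hS.smooth_N s), covDir_smul hz (hS.smooth_B s), hT, hS.deriv_N s hs,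
    hS.deriv_B s hs]
  simp only [fderiv_apply_one_eq_deriv]
  module

/-- The Jacobi operator on a multiple of the principal normal, in the Frenet frame. -/
lemma jacobi_smul_normal (hS : FrenetSystem g a b c N B k τ) {K : ℝ}
    (hK : HasConstantCurvature g K) {s : ℝ} (hs : s ∈ Ioo a b) {f : ℝ → ℝ}
    (hf : ∀ᶠ u in 𝓝 s, ContDiffAt ℝ ∞ f u) {X : ℝ → EuclideanSpace ℝ (Fin n)}
    (hX : X =ᶠ[𝓝 s] fun u => f u • N u) :
    jacobi g c X s
      = (-(2 * k s * deriv f s + f s * deriv k s)) • velDir c (1 : ℝ) s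
        + ((deriv (deriv f) s + (K - k s ^ 2 - τ s ^ 2) * f s) • N s
          + (2 * τ s * deriv f s + f s * deriv τ s) • B s) := by
  have hs' := Ioo_subset_Icc_self hs
  have hev : ∀ᶠ u in 𝓝 s, u ∈ Ioo a b := isOpen_Ioo.mem_nhds hs
  have h0 : covDir g c (fun u => f u • N u) (1 : ℝ) =ᶠ[𝓝 s] fun u =>
      (-(k u * f u)) • velDir c (1 : ℝ) u + (deriv f u • N u + (τ u * f u) • B u) := by
    filter_upwards [hev, hf] with u hu hfu
    have h := hS.covDir_combination (Ioo_subset_Icc_self hu) (x := fun _ => 0) (z := fun _ => 0)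
      contDiffAt_const hfu contDiffAt_const
    simp only [zero_smul, zero_add, add_zero, deriv_const, zero_sub, mul_zero, sub_zero] at h
    rw [h]
  have sf := hf.self_of_nhds
  have sf' : ContDiffAt ℝ ∞ (deriv f) s := by
    have : deriv f = fun u => fderiv ℝ f u 1 := funext fun u => fderiv_apply_one_eq_deriv.symm
    rw [this]
    exact (sf.fderiv_right (m := ∞) (by simp)).clm_apply contDiffAt_const
  have hk := hS.smooth_k.contDiffAt (x := s)
  have hτ := hS.smooth_τ.contDiffAt (x := s)
  have dk := (hk.differentiableAt (by simp)).hasDerivAt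
  have dτ := (hτ.differentiableAt (by simp)).hasDerivAt
  have df := (sf.differentiableAt (by simp)).hasDerivAt
  have d1 : deriv (fun u => -(k u * f u)) s = -(deriv k s * f s + k s * deriv f s) :=
    (dk.mul df).neg.deriv
  have d2 : deriv (fun u => τ u * f u) s = deriv τ s * f s + τ s * deriv f s := (dτ.mul df).deriv
  rw [jacobi_congr hX, jacobi, covDir_congr h0,
    hS.covDir_combination hs' (hk.mul sf).neg sf' (hτ.mul sf),
    curv_eq_of_hasConstantCurvature g hK, hS.inner_TT s hs', metric_smul_left,
    metric_symm g (c s) (N s), hS.inner_TN s hs', d1, d2]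
  module

lemma coeff_eq_zero (hS : FrenetSystem g a b c N B k τ) {s : ℝ} (hs : s ∈ Icc a b) {x y z : ℝ}
    (h : x • velDir c (1 : ℝ) s + (y • N s + z • B s) = 0) : x = 0 ∧ y = 0 ∧ z = 0 := by
  have h0 : ∀ w, metric g (c s) 0 w = 0 := fun w => by
    simpa using metric_smul_left g (c s) 0 0 w
  have key : ∀ w, x * metric g (c s) (velDir c (1 : ℝ) s) w
      + (y * metric g (c s) (N s) w + z * metric g (c s) (B s) w) = 0 := fun w => by
    rw [← h0 w, ← h]
    simp only [metric_add_left, metric_smul_left]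
  have hT := key (velDir c (1 : ℝ) s)
  have hN := key (N s)
  have hB := key (B s)
  rw [hS.inner_TT s hs, metric_symm g _ (N s), hS.inner_TN s hs, metric_symm g _ (B s),
    hS.inner_TB s hs] at hT
  rw [hS.inner_TN s hs, hS.inner_NN s hs, metric_symm g _ (B s), hS.inner_NB s hs] at hN
  rw [hS.inner_TB s hs, hS.inner_NB s hs, hS.inner_BB s hs] at hB
  exact ⟨by linarith, by linarith, by linarith⟩

lemma curveTensSq_eq (hS : FrenetSystem g a b c N B k τ) {s : ℝ} (hs : s ∈ Icc a b) :
    curveTensSq g c s = k s ^ 2 := by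
  rw [curveTensSq, hS.deriv_T s hs, metric_smul_left, metric_smul_right, hS.inner_NN s hs]
  ring

lemma curveTensSq_pos (hS : FrenetSystem g a b c N B k τ) {s : ℝ} (hs : s ∈ Icc a b) :
    0 < curveTensSq g c s := by
  rw [hS.curveTensSq_eq hs]
  exact pow_pos (hS.k_pos s hs) 2

lemma momentum_eq (hS : FrenetSystem g a b c N B k τ) (p : ℝ) {s : ℝ} (hs : s ∈ Icc a b) :
    momentum g p c s = k s ^ (p - 1) • N s := by
  have hk := hS.k_pos s hs
  rw [momentum, hS.deriv_T s hs, hS.curveTensSq_eq hs, smul_smul, ← Real.rpow_natCast,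
    ← Real.rpow_mul hk.le]
  congr 1
  conv_lhs => enter [2]; rw [← Real.rpow_one (k s)]
  rw [← Real.rpow_add hk]
  congr 1
  push_cast
  ring

/-- The components of the Euler–Lagrange equation in the Frenet frame. -/
lemma eulerLagrange (hS : FrenetSystem g a b c N B k τ) {K : ℝ}
    (hK : HasConstantCurvature g K) {p : ℝ} (hp : 0 < p) (hab : a < b)
    (hc : IsPBiharmonic g p a b c) {s : ℝ} (hs : s ∈ Ioo a b) :
    2 * k s * deriv (fun u => k u ^ (p - 1)) s + k s ^ (p - 1) * deriv k s = 0 ∧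
    deriv (deriv fun u => k u ^ (p - 1)) s
      + (K - k s ^ 2 - τ s ^ 2) * k s ^ (p - 1) = 0 ∧
    2 * τ s * deriv (fun u => k u ^ (p - 1)) s + k s ^ (p - 1) * deriv τ s = 0 := by
  have hev : ∀ᶠ u in 𝓝 s, u ∈ Ioo a b := isOpen_Ioo.mem_nhds hs
  have h := jacobi_momentum_eq_zero hK hp hab hc (fun u hu => hS.curveTensSq_pos hu) hs
  rw [hS.jacobi_smul_normal hK hs (f := fun u => k u ^ (p - 1))
    (hev.mono fun u hu => hS.smooth_k.contDiffAt.rpow_const_of_ne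
      (hS.k_pos u (Ioo_subset_Icc_self hu)).ne')
    (hev.mono fun u hu => hS.momentum_eq p (Ioo_subset_Icc_self hu))] at h
  obtain ⟨h1, h2, h3⟩ := hS.coeff_eq_zero (Ioo_subset_Icc_self hs) h
  exact ⟨neg_eq_zero.1 h1, h2, h3⟩

lemma deriv_rpow (hS : FrenetSystem g a b c N B k τ) (p : ℝ) {s : ℝ} (hs : s ∈ Icc a b) :
    deriv (fun u => k u ^ (p - 1)) s = (p - 1) * k s ^ (p - 2) * deriv k s := by
  have dk := ((hS.smooth_k.contDiffAt (x := s)).differentiableAt (by simp)).hasDerivAt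
  rw [(dk.rpow_const (p := p - 1) (Or.inl (hS.k_pos s hs).ne')).deriv,
    show p - 1 - 1 = p - 2 by ring]
  ring

lemma rpow_eq_mul (hS : FrenetSystem g a b c N B k τ) (x : ℝ) (m : ℕ) {s : ℝ} (hs : s ∈ Icc a b) :
    k s ^ (x + m) = k s ^ x * k s ^ m := by
  rw [Real.rpow_add (hS.k_pos s hs), Real.rpow_natCast]

lemma deriv_k_eq_zero (hS : FrenetSystem g a b c N B k τ) {K : ℝ}
    (hK : HasConstantCurvature g K) {p : ℝ} (hp : 0 < p) (hab : a < b)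
    (hc : IsPBiharmonic g p a b c) (hp' : p ≠ 1 / 2) {s : ℝ} (hs : s ∈ Ioo a b) :
    deriv k s = 0 := by
  have hs' := Ioo_subset_Icc_self hs
  have h := (hS.eulerLagrange hK hp hab hc hs).1
  have hpow : k s ^ (p - 1) = k s ^ (p - 2) * k s ^ 1 := by
    rw [← hS.rpow_eq_mul (p - 2) 1 hs']
    congr 1
    push_cast
    ring
  rw [hS.deriv_rpow p hs', hpow] at h
  have hne : (2 * p - 1) * (k s ^ (p - 2) * k s) ≠ 0 :=
    mul_ne_zero (fun h => hp' (by linarith))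
      (mul_pos (Real.rpow_pos_of_pos (hS.k_pos s hs') _) (hS.k_pos s hs')).ne'
  refine (mul_eq_zero.1 ?_).resolve_left hne
  linear_combination h

end FrenetSystem

lemma eq_zero_on_Icc_of_Ioo {f : ℝ → ℝ} (hf : Continuous f) (hab : a < b)
    (h : ∀ s ∈ Ioo a b, f s = 0) : ∀ s ∈ Icc a b, f s = 0 := by
  intro s hs
  rw [← closure_Ioo hab.ne] at hs
  exact (isClosed_eq hf continuous_const).closure_subset_iff.2 h hs

lemma eq_left_of_deriv_eq_zero {f : ℝ → ℝ} (hf : ∀ s ∈ Icc a b, HasDerivAt f 0 s) :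
    ∀ s ∈ Icc a b, f s = f a :=
  constant_of_has_deriv_right_zero
    (fun s hs => (hf s hs).continuousAt.continuousWithinAt)
    fun s hs => (hf s (Ico_subset_Icc_self hs)).hasDerivWithinAt

lemma integral_congr_Ioo_of_lt {f h : ℝ → ℝ} (hab : a < b) (H : ∀ s ∈ Ioo a b, f s = h s) :
    ∫ s in a..b, f s = ∫ s in a..b, h s := by
  rw [intervalIntegral.integral_of_le hab.le, intervalIntegral.integral_of_le hab.le,
    MeasureTheory.integral_Ioc_eq_integral_Ioo, MeasureTheory.integral_Ioc_eq_integral_Ioo]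
  exact MeasureTheory.setIntegral_congr_fun measurableSet_Ioo H

end Frenet

/-! ### The Hessian in the direction of the principal normal -/

section Hessian

/-- The integrand of the second variation of the `p`-bienergy in the direction of the principal
normal. -/
def hessianDensity (K p : ℝ) (k τ : ℝ → ℝ) (s : ℝ) : ℝ :=
  (p - 1) * k s ^ (p - 2) * (k s ^ 2 + τ s ^ 2) ^ 2
    + (deriv k s ^ 2 + deriv τ s ^ 2) * k s ^ (p - 2)
    + (p - 1) * K ^ 2 * k s ^ (p - 2)
    - (2 * p + 2) * K * k s ^ p
    + (2 - 2 * p) * K * τ s ^ 2 * k s ^ (p - 2)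

variable {n : ℕ} {M : Type*} [TopologicalSpace M]
  [ChartedSpace (EuclideanSpace ℝ (Fin n)) M] [IsManifold (𝓡 n) ∞ M]
  {g : Metric n M} {a b : ℝ} {c : ℝ → M} {N B : ℝ → EuclideanSpace ℝ (Fin n)} {k τ : ℝ → ℝ}
  {F : ℝ × ℝ → M}

namespace FrenetSystem

lemma continuousOn_hessianDensity (hS : FrenetSystem g a b c N B k τ) (K p : ℝ) :
    ContinuousOn (hessianDensity K p k τ) (Icc a b) := by
  have hk := hS.smooth_k.continuous
  have hτ := hS.smooth_τ.continuous
  have hk' : Continuous (deriv k) := hS.smooth_k.continuous_deriv (by simp)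
  have hτ' : Continuous (deriv τ) := hS.smooth_τ.continuous_deriv (by simp)
  have hpow : ∀ q : ℝ, ContinuousOn (fun s => k s ^ q) (Icc a b) := fun q =>
    hk.continuousOn.rpow_const fun s hs => Or.inl (hS.k_pos s hs).ne'
  have h1 := hpow (p - 2)
  have h2 := hpow p
  unfold hessianDensity
  fun_prop

/-- For a variation in the direction of the principal normal, the second derivative of the energy
density splits into an explicit term and a term that is linear in the acceleration. -/
lemma density₂_slice (hS : FrenetSystem g a b c N B k τ) {K : ℝ} (hK : HasConstantCurvature g K)
    (p : ℝ) (hF : ContMDiff 𝓘(ℝ, ℝ × ℝ) (𝓡 n) ∞ F) (hFc : ∀ u, F (0, u) = c u)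
    (hV : ∀ s ∈ Icc a b, velDir F (1, 0) (0, s) = N s) {s : ℝ} (hs : s ∈ Ioo a b) :
    density₂ g p F (0, s) = hessianDensity K p k τ s
      + metric g (c s) (jacobi g c (fun u => covDir g F (velDir F (1, 0)) (1, 0) (0, u)) s)
        (momentum g p c s) := by
  have hs' := Ioo_subset_Icc_self hs
  have hk := hS.k_pos s hs'
  have hev : ∀ᶠ u in 𝓝 s, u ∈ Ioo a b := isOpen_Ioo.mem_nhds hs
  have sV := FieldSmoothAt.velDir (n := n) hF (1, 0)
  have hVN : (fun u => velDir F (1, 0) (0, u)) =ᶠ[𝓝 s] N :=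
    hev.mono fun u hu => hV u (Ioo_subset_Icc_self hu)
  have hW : tens g F (0, s) = k s • N s := by rw [tens_slice hF hFc, hS.deriv_T s hs']
  have hDV : covDir g F (velDir F (1, 0)) (0, 1) (0, s)
      = (-k s) • velDir c (1 : ℝ) s + τ s • B s := by
    rw [covDir_slice hF hFc sV, covDir_congr hVN, hS.deriv_N s hs']
  have hJ : covDir g F (tens g F) (1, 0) (0, s)
      = (-deriv k s) • velDir c (1 : ℝ) s
        + ((K - k s ^ 2 - τ s ^ 2) • N s + deriv τ s • B s) := by
    rw [covDir_tens_slice hF hFc, hS.jacobi_smul_normal hK hs (f := fun _ => 1)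
      (Eventually.of_forall fun _ => contDiffAt_const) (hVN.trans (by simp))]
    simp
  have hJJ := covDir_covDir_tension hF hK (1, 0) (0, 1) (0, s) (hV s hs') (velDir_slice hF hFc s)
    hW hDV rfl
  rw [covDir_covDir_slice hF hFc (FieldSmoothAt.covDir_of_forall g hF sV _)] at hJJ
  change covDir g F (covDir g F (tens g F) (1, 0)) (1, 0) (0, s) = _ at hJJ
  rw [density₂, tensSq_slice hF hFc, hS.curveTensSq_eq hs', hJJ, hJ, hW, hS.momentum_eq p hs', hFc,
    jacobi]
  have e1 : (k s ^ 2) ^ (p / 2 - 1) = k s ^ (p - 2) := by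
    rw [← Real.rpow_natCast, ← Real.rpow_mul hk.le]
    congr 1
    push_cast
    ring
  have e2 : (k s ^ 2) ^ (p / 2 - 2) * k s ^ 2 = k s ^ (p - 2) := by
    rw [← e1, show p / 2 - 1 = p / 2 - 2 + 1 by ring, Real.rpow_add_one (by positivity)]
  have e3 : k s ^ (p - 1) = k s ^ (p - 2) * k s := by
    rw [show p - 1 = p - 2 + (1 : ℕ) by push_cast; ring, hS.rpow_eq_mul _ _ hs', pow_one]
  have e4 : k s ^ p = k s ^ (p - 2) * k s ^ 2 := by
    rw [← hS.rpow_eq_mul _ _ hs']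
    congr 1
    push_cast
    ring
  have mTT := hS.inner_TT s hs'
  have mNN := hS.inner_NN s hs'
  have mBB := hS.inner_BB s hs'
  have mTN := hS.inner_TN s hs'
  have mTB := hS.inner_TB s hs'
  have mNB := hS.inner_NB s hs'
  have mNT := (metric_symm g (c s) (N s) _).trans mTN
  have mBT := (metric_symm g (c s) (B s) _).trans mTB
  have mBN := (metric_symm g (c s) (B s) _).trans mNB
  simp only [metric_add_left, metric_add_right, metric_sub_left, metric_smul_left,
    metric_smul_right, mTT, mNN, mBB, mTN, mTB, mNB, mNT, mBT, mBN, hessianDensity, e3, e4]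
  rw [e1]
  linear_combination (p - 2) * (K - k s ^ 2 - τ s ^ 2) ^ 2 * e2

end FrenetSystem

lemma momentum_add_period {L : ℝ} (hc : ∀ s, c (s + L) = c s) (p s : ℝ) :
    momentum g p c (s + L) = momentum g p c s := by
  have h : ∀ s, curveTens g c (s + L) = curveTens g c s :=
    covDir_add_period hc (velDir_add_period hc)
  simp only [momentum, curveTensSq, h, hc]

lemma boundaryTerm_add_period {L : ℝ} (hc : ∀ s, c (s + L) = c s)
    {A : ℝ → EuclideanSpace ℝ (Fin n)} (hA : ∀ s, A (s + L) = A s) (p s : ℝ) :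
    boundaryTerm g p c A (s + L) = boundaryTerm g p c A s := by
  simp only [boundaryTerm, momentum_add_period hc, hc, hA, covDir_add_period hc hA,
    covDir_add_period hc (momentum_add_period hc p)]

lemma boundaryTerm_eq_zero {A : ℝ → EuclideanSpace ℝ (Fin n)} {s : ℝ} (p : ℝ) (hA : A s = 0)
    (hA' : covDir g c A (1 : ℝ) s = 0) : boundaryTerm g p c A s = 0 := by
  have h0 : ∀ w, metric g (c s) 0 w = 0 := fun w => by
    simpa using metric_smul_left g (c s) 0 0 w
  rw [boundaryTerm, hA, hA', h0, h0, sub_zero]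

/-- The Hessian of the `p`-bienergy in the direction of the principal normal. -/
lemma FrenetSystem.hasHessian (hS : FrenetSystem g a b c N B k τ) {K : ℝ}
    (hK : HasConstantCurvature g K) {p : ℝ} (hp : 0 < p) (hab : a < b)
    (hc : IsPBiharmonic g p a b c) :
    HasHessian g p a b c N (∫ s in a..b, hessianDensity K p k τ s) := by
  rintro Γ ⟨⟨hΓ, hΓc⟩, hfield, hbd⟩
  set F : ℝ × ℝ → M := fun q => Γ q.1 q.2 with hFdef
  have hF : ContMDiff 𝓘(ℝ, ℝ × ℝ) (𝓡 n) ∞ F := hΓ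
  have hFc : ∀ u, F (0, u) = c u := hΓc
  have hpos : ∀ s ∈ Icc a b, 0 < tensSq g F (0, s) := fun s hs => by
    rw [tensSq_slice hF hFc]
    exact hS.curveTensSq_pos hs
  have hE : ∀ᶠ t in 𝓝 (0 : ℝ), HasDerivAt (fun t => energy g p a b (Γ t))
      (∫ s in a..b, density₁ g p F (t, s)) t := by
    filter_upwards [eventually_forall_mem_of_isOpen (isOpen_tensSq_pos g hF) hpos] with t ht
    exact hasDerivAt_energy g hF hp hab.le ht
  refine ⟨hE.mono fun t ht => ht.differentiableAt, ?_⟩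
  have h2 := (hasDerivAt_integral_density₁ g hF p hab.le hpos).congr_of_eventuallyEq
    (hE.mono fun t ht => ht.deriv)
  refine h2.congr_deriv ?_
  have hV : ∀ s ∈ Icc a b, velDir F (1, 0) (0, s) = N s := by
    intro s hs
    have e1 : velDir (n := n) (fun t => F (t, s)) (1 : ℝ) 0 = velDir F (1, 0) (0, s) :=
      velDir_comp hF (hasDerivAt_pair_left 0 s)
    have e2 : velocity (n := n) (fun t => Γ t s) 0 = velDir (fun t => F (t, s)) (1 : ℝ) 0 :=
      velocity_eq_velDir (contMDiff_slice hF (ι := fun t => (t, s)) (by fun_prop)) 0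
    have e3 : (velocity (n := n) (fun t => Γ t s) 0 : EuclideanSpace ℝ (Fin n)) = N s :=
      eq_of_heq (Bundle.TotalSpace.mk.inj (hfield s hs)).2
    exact e1.symm.trans (e2.symm.trans e3)
  set A : ℝ → EuclideanSpace ℝ (Fin n) :=
    fun u => covDir g F (velDir F (1, 0)) (1, 0) (0, u) with hA
  have sA' := FieldSmoothAt.covDir_of_forall g hF (FieldSmoothAt.velDir (n := n) hF (1, 0)) (1, 0)
  have sA : ∀ s, FieldSmoothAt c A s := by
    intro s
    have h := FieldSmoothAt.comp (ι := fun u => ((0 : ℝ), u)) (by fun_prop) (s := s) (sA' (0, s))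
    simpa only [hFc] using h
  have hAt : ∀ s, tension g (fun t => Γ t s) 0 = A s := fun s =>
    tension_comp g hF (ι := fun t => (t, s)) (by fun_prop) (fun t => hasDerivAt_pair_left t s) 0
  have hB : boundaryTerm g p c A b = boundaryTerm g p c A a := by
    rcases hbd with hper | hzero
    · have hcp : ∀ s, c (s + (b - a)) = c s := fun s => by rw [← hΓc, hper, hΓc]
      have hAp : ∀ s, A (s + (b - a)) = A s := fun s => by
        have h : (fun t => Γ t (s + (b - a))) = fun t => Γ t s := funext fun t => hper t s
        exact (hAt _).symm.trans ((congrArg (fun c : ℝ → M =>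
          (tension g c 0 : EuclideanSpace ℝ (Fin n))) h).trans (hAt s))
      rw [← boundaryTerm_add_period hcp hAp p a, add_sub_cancel]
    · have hz : ∀ s, s = a ∨ s = b → boundaryTerm g p c A s = 0 := by
        intro s hs
        obtain ⟨h1, h2⟩ := hzero s hs
        refine boundaryTerm_eq_zero p ((hAt s).symm.trans h1) ?_
        rw [← covDeriv_eq_covDir g hc.1]
        obtain rfl : c = fun u => Γ 0 u := funext fun u => (hΓc u).symm
        have h : A = fun u => tension g (fun t => Γ t u) 0 := funext fun u => (hAt u).symm
        exact (congrArg (fun X : ℝ → EuclideanSpace ℝ (Fin n) =>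
          (covDeriv g (fun u => Γ 0 u) X s : EuclideanSpace ℝ (Fin n))) h).trans h2
      rw [hz a (Or.inl rfl), hz b (Or.inr rfl)]
  have hJ := integral_jacobi hK hc.1 p hab.le (fun s hs => hS.curveTensSq_pos hs) sA
  have hEL : ∫ s in a..b, metric g (c s) (A s) (jacobi g c (momentum g p c) s) = 0 := by
    rw [integral_congr_Ioo_of_lt hab (h := fun _ => 0) fun s hs => ?_]
    · simp
    · rw [jacobi_momentum_eq_zero hK hp hab hc (fun s hs => hS.curveTensSq_pos hs) hs]
      simpa using metric_smul_right g (c s) 0 0 (A s)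
  rw [hB, sub_self, zero_add, hEL] at hJ
  rw [integral_congr_Ioo_of_lt hab fun s hs => hS.density₂_slice hK p hF hFc hV hs,
    intervalIntegral.integral_add, hJ, add_zero]
  · refine ContinuousOn.intervalIntegrable ?_
    rw [uIcc_of_le hab.le]
    exact hS.continuousOn_hessianDensity K p
  · refine ContinuousOn.intervalIntegrable ?_
    rw [uIcc_of_le hab.le]
    exact fun s hs => (contDiffAt_metric g hc.1
      (fieldSmoothAt_jacobi hK hc.1 (Eventually.of_forall sA))
      (fieldSmoothAt_momentum hc.1 p (hS.curveTensSq_pos hs))).continuousAt.continuousWithinAt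

namespace FrenetSystem

/-- If `p ≠ 1 / 2` then the curvature and the torsion are constant, and `k ^ 2 + τ ^ 2 = K`. -/
lemma integral_hessianDensity_of_ne (hS : FrenetSystem g a b c N B k τ) {K : ℝ}
    (hK : HasConstantCurvature g K) {p : ℝ} (hp : 0 < p) (hab : a < b)
    (hc : IsPBiharmonic g p a b c) (hp' : p ≠ 1 / 2) :
    (∀ s ∈ Icc a b, k s = k a) ∧
      ∫ s in a..b, hessianDensity K p k τ s = -4 * K * (b - a) * k a ^ p := by
  have hk' := eq_zero_on_Icc_of_Ioo (hS.smooth_k.continuous_deriv (by simp)) hab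
    fun s hs => hS.deriv_k_eq_zero hK hp hab hc hp' hs
  have hconst : ∀ s ∈ Icc a b, k s = k a := eq_left_of_deriv_eq_zero fun s hs => by
    rw [← hk' s hs]
    exact ((hS.smooth_k.contDiffAt (x := s)).differentiableAt (by simp)).hasDerivAt
  refine ⟨hconst, ?_⟩
  rw [integral_congr_Ioo_of_lt hab (h := fun _ => -4 * K * k a ^ p) fun s hs => ?_]
  · rw [intervalIntegral.integral_const, smul_eq_mul]
    ring
  have hs' := Ioo_subset_Icc_self hs
  obtain ⟨-, h2, h3⟩ := hS.eulerLagrange hK hp hab hc hs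
  have hd : ∀ u ∈ Ioo a b, deriv (fun u => k u ^ (p - 1)) u = 0 := fun u hu => by
    rw [hS.deriv_rpow p (Ioo_subset_Icc_self hu), hk' u (Ioo_subset_Icc_self hu), mul_zero]
  have hdd : deriv (deriv fun u => k u ^ (p - 1)) s = 0 := by
    have : deriv (fun u => k u ^ (p - 1)) =ᶠ[𝓝 s] fun _ => 0 :=
      Filter.mem_of_superset (isOpen_Ioo.mem_nhds hs) hd
    rw [this.deriv_eq, deriv_const]
  have hne : k s ^ (p - 1) ≠ 0 := (Real.rpow_pos_of_pos (hS.k_pos s hs') _).ne'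
  have hτ' : deriv τ s = 0 := by
    rw [hd s hs, mul_zero, zero_add] at h3
    exact (mul_eq_zero.1 h3).resolve_left hne
  have hKeq : K - k s ^ 2 - τ s ^ 2 = 0 := by
    rw [hdd, zero_add] at h2
    exact (mul_eq_zero.1 h2).resolve_right hne
  have e4 : k s ^ p = k s ^ (p - 2) * k s ^ 2 := by
    rw [← hS.rpow_eq_mul _ _ hs']
    congr 1
    push_cast
    ring
  rw [hessianDensity, hk' s hs', hτ', ← hconst s hs', e4,
    show K = k s ^ 2 + τ s ^ 2 by linarith]
  ring

/-- If `p = 1 / 2` then the torsion is a constant multiple of the curvature. -/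
lemma exists_torsion_eq (hS : FrenetSystem g a b c N B k τ) {K : ℝ}
    (hK : HasConstantCurvature g K) (hab : a < b) (hc : IsPBiharmonic g (1 / 2) a b c) :
    ∃ α : ℝ, ∀ s ∈ Icc a b, τ s = α * k s := by
  have hk' : Continuous (deriv k) := hS.smooth_k.continuous_deriv (by simp)
  have hτ' : Continuous (deriv τ) := hS.smooth_τ.continuous_deriv (by simp)
  have hcross : ∀ s ∈ Icc a b, deriv τ s * k s - τ s * deriv k s = 0 := by
    refine eq_zero_on_Icc_of_Ioo ((hτ'.mul hS.smooth_k.continuous).sub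
      (hS.smooth_τ.continuous.mul hk')) hab fun s hs => ?_
    have hs' := Ioo_subset_Icc_self hs
    have h3 := (hS.eulerLagrange hK (by norm_num) hab hc hs).2.2
    have hpow : k s ^ ((1 : ℝ) / 2 - 1) = k s ^ ((1 : ℝ) / 2 - 2) * k s := by
      conv_rhs => rw [← pow_one (k s), ← Real.rpow_natCast, ← Real.rpow_mul (hS.k_pos s hs').le,
        ← Real.rpow_add (hS.k_pos s hs')]
      congr 1
      norm_num
    rw [hS.deriv_rpow _ hs', hpow] at h3
    refine (mul_eq_zero.1 ?_).resolve_left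
      (Real.rpow_pos_of_pos (hS.k_pos s hs') ((1 : ℝ) / 2 - 2)).ne'
    linear_combination h3
  have hquot : ∀ s ∈ Icc a b, τ s / k s = τ a / k a := by
    refine eq_left_of_deriv_eq_zero (f := fun s => τ s / k s) fun s hs => ?_
    have dk := ((hS.smooth_k.contDiffAt (x := s)).differentiableAt (by simp)).hasDerivAt
    have dτ := ((hS.smooth_τ.contDiffAt (x := s)).differentiableAt (by simp)).hasDerivAt
    refine (dτ.div dk (hS.k_pos s hs).ne').congr_deriv ?_
    rw [hcross s hs, zero_div]
  exact ⟨τ a / k a, fun s hs => by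
    rw [← hquot s hs, div_mul_cancel₀ _ (hS.k_pos s hs).ne']⟩

lemma integral_hessianDensity_of_eq (hS : FrenetSystem g a b c N B k τ) (K : ℝ) (hab : a < b)
    {α : ℝ} (hα : ∀ s ∈ Icc a b, τ s = α * k s) :
    ∫ s in a..b, hessianDensity K (1 / 2) k τ s = ∫ s in a..b,
      (-((1 + α ^ 2) ^ 2 / 2) * k s ^ (5 / 2 : ℝ)
        + (1 + α ^ 2) * deriv k s ^ 2 * k s ^ (-(3 / 2) : ℝ)
        - 1 / 2 * K ^ 2 * k s ^ (-(3 / 2) : ℝ)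
        - 3 * K * k s ^ (1 / 2 : ℝ)
        + α ^ 2 * K * k s ^ (1 / 2 : ℝ)) := by
  refine integral_congr_Ioo_of_lt hab fun s hs => ?_
  have hs' := Ioo_subset_Icc_self hs
  have hτ' : deriv τ s = α * deriv k s := by
    have : τ =ᶠ[𝓝 s] fun u => α * k u :=
      Filter.mem_of_superset (isOpen_Ioo.mem_nhds hs) fun u hu => hα u (Ioo_subset_Icc_self hu)
    rw [this.deriv_eq, deriv_const_mul _ ((hS.smooth_k.contDiffAt (x := s)).differentiableAt
      (by simp))]
  have e1 : k s ^ (5 / 2 : ℝ) = k s ^ (-(3 / 2) : ℝ) * k s ^ 4 := by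
    rw [← hS.rpow_eq_mul _ _ hs']
    norm_num
  have e2 : k s ^ (1 / 2 : ℝ) = k s ^ (-(3 / 2) : ℝ) * k s ^ 2 := by
    rw [← hS.rpow_eq_mul _ _ hs']
    norm_num
  rw [hessianDensity, hτ', hα s hs', show (1 / 2 - 2 : ℝ) = -(3 / 2) by norm_num, e1, e2]
  ring

end FrenetSystem

end Hessian

section FrenetFrame

variable {M : Type*} [TopologicalSpace M]
  [ChartedSpace (EuclideanSpace ℝ (Fin 3)) M] [IsManifold (𝓡 3) ∞ M]

/-- The frame fields, given as sections of the tangent bundle along the curve, are smooth in charts,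
and their derivatives agree with the directional covariant derivative `covDir`. -/
lemma IsFrenetFrame.frenetSystem {g : Metric 3 M} {a b : ℝ} {c : ℝ → M}
    (hc : ContMDiff 𝓘(ℝ, ℝ) (𝓡 3) ∞ c) {N B : ∀ s, TangentSpace (𝓡 3) (c s)} {k τ : ℝ → ℝ}
    (h : IsFrenetFrame g a b c N B k τ) : FrenetSystem g a b c N B k τ := by
  have hT : ∀ s, velocity (n := 3) c s = velDir c (1 : ℝ) s := velocity_eq_velDir hc
  have smooth : ∀ X : ∀ s, TangentSpace (𝓡 3) (c s), ContMDiff 𝓘(ℝ, ℝ) (𝓡 3).tangent ∞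
      (fun s => (⟨c s, X s⟩ : TangentBundle (𝓡 3) M)) → ∀ s, FieldSmoothAt c X s := fun X hX s =>
    contMDiffAt_iff_contDiffAt.1 (Bundle.contMDiffAt_totalSpace.1 (hX s)).2
  refine ⟨hc, smooth N h.smooth_N, smooth B h.smooth_B, h.smooth_k, h.smooth_τ, fun s hs => ?_,
    h.inner_NN, h.inner_BB, fun s hs => ?_, fun s hs => ?_, h.inner_NB, h.k_pos, fun s hs => ?_,
    fun s hs => ?_, fun s hs => ?_⟩
  · rw [← hT]
    exact h.inner_TT s hs
  · rw [← hT]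
    exact h.inner_TN s hs
  · rw [← hT]
    exact h.inner_TB s hs
  · exact (tension_eq_covDir g hc s).symm.trans (h.deriv_T s hs)
  · have neg_smul_add : ∀ (r : ℝ) (v w : EuclideanSpace ℝ (Fin 3)),
        -(r • v) + w = (-r) • v + w := fun r v w => by rw [neg_smul]
    rw [← hT]
    exact (covDeriv_eq_covDir g hc N s).symm.trans
      ((h.deriv_N s hs).trans (neg_smul_add (k s) (velocity c s) (τ s • B s)))
  · have neg_smul' : ∀ (r : ℝ) (v : EuclideanSpace ℝ (Fin 3)), -(r • v) = (-r) • v :=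
      fun r v => by rw [neg_smul]
    exact (covDeriv_eq_covDir g hc B s).symm.trans
      ((h.deriv_B s hs).trans (neg_smul' (τ s) (N s)))

end FrenetFrame

end PBiharmonic

end

theorem mainTheorem9 {M : Type*} [TopologicalSpace M] [T2Space M]
    [ChartedSpace (EuclideanSpace ℝ (Fin 3)) M] [IsManifold (𝓡 3) ∞ M]
    (g : PBiharmonic.Metric 3 M) (K : ℝ) (hK : PBiharmonic.HasConstantCurvature g K)
    (p a b : ℝ) (hp : 0 < p) (hab : a < b)
    (γ : ℝ → M) (hγ : PBiharmonic.IsPBiharmonic g p a b γ)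
    (N B : ∀ s, TangentSpace (𝓡 3) (γ s)) (k τ : ℝ → ℝ)
    (hF : PBiharmonic.IsFrenetFrame g a b γ N B k τ) :
    PBiharmonic.HasHessian g p a b γ N
      (∫ s in a..b,
        ((p - 1) * k s ^ (p - 2) * (k s ^ 2 + τ s ^ 2) ^ 2
          + (deriv k s ^ 2 + deriv τ s ^ 2) * k s ^ (p - 2)
          + (p - 1) * K ^ 2 * k s ^ (p - 2)
          - (2 * p + 2) * K * k s ^ p
          + (2 - 2 * p) * K * τ s ^ 2 * k s ^ (p - 2))) ∧
    (p ≠ 1 / 2 → ∃ k₀ : ℝ, (∀ s ∈ Icc a b, k s = k₀) ∧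
      PBiharmonic.HasHessian g p a b γ N (-4 * K * (b - a) * k₀ ^ p)) ∧
    (p = 1 / 2 → ∃ α : ℝ, (∀ s ∈ Icc a b, τ s = α * k s) ∧
      PBiharmonic.HasHessian g p a b γ N
        (∫ s in a..b,
          (-((1 + α ^ 2) ^ 2 / 2) * k s ^ (5 / 2 : ℝ)
            + (1 + α ^ 2) * deriv k s ^ 2 * k s ^ (-(3 / 2) : ℝ)
            - 1 / 2 * K ^ 2 * k s ^ (-(3 / 2) : ℝ)
            - 3 * K * k s ^ (1 / 2 : ℝ)
            + α ^ 2 * K * k s ^ (1 / 2 : ℝ)))) := by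
  have hS := hF.frenetSystem hγ.1
  have hH := hS.hasHessian hK hp hab hγ
  refine ⟨hH, fun hp' => ?_, fun hp' => ?_⟩
  · obtain ⟨hk, hI⟩ := hS.integral_hessianDensity_of_ne hK hp hab hγ hp'
    exact ⟨k a, hk, hI ▸ hH⟩
  · subst hp'
    obtain ⟨α, hα⟩ := hS.exists_torsion_eq hK hab hγ
    exact ⟨α, hα, hS.integral_hessianDensity_of_eq K hab hα ▸ hH⟩
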